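/- Let $(Y_t)_{t\ge 1}$ be a real-valued, strictly stationary, $1$-dependent sequence (for every $s\ge 1$, $(Y_t)_{t\le s}$ is independent of $(Y_t)_{t\ge s+2}$) with finite second moments, $\mathbb{E}(Y_t)=\theta^*$, $\mathbb{E}[(Y_t-\theta^*)^2]=r(0)$ and $\mathbb{E}[(Y_t-\theta^*)(Y_{t+1}-\theta^*)]=r(1)$. Let $(V_t)_{t\ge 1}$ be i.i.d. real random variables with mean one and unit variance, independent of $(Y_t)_{t\ge 1}$. Let $\gamma_t=(t+\gamma)^{-\rho}$ with $\gamma>0$ and $\rho\in(1/2,1)$, let $\widehat\theta_0,\widehat\theta_0^*\in\mathbb{R}$ be arbitrary (deterministic) initial values, and for $t\ge 1$ put $$\widehat\theta_t=\widehat\theta_{t-1}+\gamma_t(Y_t-\widehat\theta_{t-1}),\qquad \widehat\theta_t^*=\widehat\theta_{t-1}^*+\gamma_tV_t(Y_t-\widehat\theta_{t-1}^*).$$ Then $r(0)\ge 0$, $r(0)+2r(1)\ge 0$, and, as $T\to\infty$, $$\sqrt T\Big(\frac1T\sum_{t=1}^T\widehat\theta_t-\theta^*\Big)\to N(0,r(0)+2r(1))\quad\text{in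 distribution},$$ $$\sqrt T\Big(\frac1T\sum_{t=1}^T\widehat\theta_t^*-\frac1T\sum_{t=1}^T\widehat\theta_t\Big)\,\Big|\,Y_1,\dots,Y_T\to N(0,r(0))\quad\text{in distribution, in probability}.$$ Here a normal law with variance $0$ is the point mass at its mean, and $X_T\,|\,D_T\to\nu$ in distribution, in probability, means that $\sup_{f}\big|\mathbb{E}[f(X_T)\mid D_T]-\int f\,d\nu\big|\to 0$ in probability, where the supremum is over all $f:\mathbb{R}\to\mathbb{R}$ with $|f|\le 1$ and $|f(x)-f(y)|\le|x-y|$ for all $x,y$, and the conditional expectations are taken with respect to the regular conditional distribution of $X_T$ given $D_T$. In particular, the two limiting laws are different whenever $r(1)\ne 0$. -/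

import Mathlib

open MeasureTheory ProbabilityTheory Filter Topology

/-- A real sequence `X 0, X 1, …` of random variables is (strictly) stationary: every shifted
sequence has the same law on `ℕ → ℝ` as the sequence itself. -/
def IsStationarySeq {Ω : Type*} [MeasurableSpace Ω] (X : ℕ → Ω → ℝ) (μ : Measure Ω) : Prop :=
  ∀ k : ℕ, IdentDistrib (fun ω t => X (t + k) ω) (fun ω t => X t ω) μ μ

/-- A sequence is `m`-dependent: for every `s`, the variables with index at most `s` are (jointly)
independent of those with index larger than `s + m`. -/
def IsMDependent {Ω : Type*} [MeasurableSpace Ω] (m : ℕ) (X : ℕ → Ω → ℝ) (μ : Measure Ω) : Prop :=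
  ∀ s : ℕ, IndepFun (fun ω (i : Set.Iic s) => X i ω) (fun ω (j : Set.Ioi (s + m)) => X j ω) μ

/-- The learning rate `γ_t = (t + γ)^{-ρ}`. -/
noncomputable def learningRate (γ ρ : ℝ) (t : ℕ) : ℝ := ((t : ℝ) + γ) ^ (-ρ)

/-- Stochastic gradient descent for the mean, along a path of data. The observations are numbered
from `0`, so that `y t` is the observation used in iteration `t + 1`:
`θ_{t+1} = θ_t + γ_{t+1} (y_t - θ_t)`. -/
noncomputable def sgdMean (γ ρ θ₀ : ℝ) (y : ℕ → ℝ) : ℕ → ℝ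
  | 0 => θ₀
  | t + 1 => sgdMean γ ρ θ₀ y t + learningRate γ ρ (t + 1) * (y t - sgdMean γ ρ θ₀ y t)

/-- Bootstrap stochastic gradient descent for the mean with multiplicative weights `v`
(`y t` and `v t` are the observation and the weight used in iteration `t + 1`):
`θ*_{t+1} = θ*_t + γ_{t+1} v_t (y_t - θ*_t)`. -/
noncomputable def bootstrapSgdMean (γ ρ θ₀ : ℝ) (v y : ℕ → ℝ) : ℕ → ℝ
  | 0 => θ₀
  | t + 1 => bootstrapSgdMean γ ρ θ₀ v y t +
      learningRate γ ρ (t + 1) * v t * (y t - bootstrapSgdMean γ ρ θ₀ v y t)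

/-- The average `(1/T) ∑_{t=1}^T θ_t` of the first `T` iterates (without the initial value). -/
noncomputable def iterateAverage (θ : ℕ → ℝ) (T : ℕ) : ℝ :=
  (1 / (T : ℝ)) * ∑ t ∈ Finset.Icc 1 T, θ t

/-- The class `BL₁` of functions on `ℝ` that are bounded by `1` and `1`-Lipschitz. -/
def BL1 : Set (ℝ → ℝ) :=
  {f | (∀ x, |f x| ≤ 1) ∧ ∀ x y, |f x - f y| ≤ |x - y|}

/-- `X_T | D_T` converges in distribution to `ν`, in probability: the bounded Lipschitz distance
`sup_{f ∈ BL₁} |E[f(X_T) | D_T] - ∫ f dν|` tends to zero in probability as `T → ∞`. The conditional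
expectations, for all `f` at once, are integrals against the regular conditional distribution of
`X_T` given `D_T`. -/
def CondTendstoInDistribution {Ω : Type*} [MeasurableSpace Ω] {β : ℕ → Type*}
    [∀ T, MeasurableSpace (β T)] (X : ℕ → Ω → ℝ) (D : (T : ℕ) → Ω → β T) (ν : Measure ℝ)
    (μ : Measure Ω) [IsFiniteMeasure μ] : Prop :=
  (∀ T, AEMeasurable (X T) μ) ∧ (∀ T, AEMeasurable (D T) μ) ∧
    TendstoInMeasure μ
      (fun T ω => ⨆ f : BL1,
        |∫ x, (f : ℝ → ℝ) x ∂(condDistrib (X T) (D T) μ (D T ω)) - ∫ x, (f : ℝ → ℝ) x ∂ν|)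
      atTop (fun _ => 0)

/-! Put e_t = Y_t - θ*. The recursions are translation equivariant (`bootstrapSgdMean_sub_const`),
and plain SGD is the bootstrap recursion with all weights equal to 1, so one analysis of D_{t+1} =
D_t + γ_{t+1} W_t (e_t - D_t), with E W_t = 1 and E W_t² = m ≤ 2, serves both. With a_t = 1/γ_t,
summing a_{t+1}(D_{t+1} - D_t) = W_t(e_t - D_t) by parts (`sum_bootstrapSgdMean_sub`) gives Σ D_t =
Σ W_t e_t plus boundary terms, the martingale -Σ (W_t - 1) D_t and the drift Σ (a_{t+1} - a_t) D_t.

These remainders are o(√T) in L¹ once E D_t² = O(γ_t) (`exists_integral_sq_randomIterate_le`). That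
bound comes from the recursion for E D_t². Serial dependence enters it only through E[D_t e_t]: by
1-dependence D_t is correlated with e_t only via its last update, so this moment is γ_t r(1) for t ≥
1 and contributes at order γ², just like the noise variance.

Hence averaged SGD is T^{-1/2} Σ e_t up to o(1), and a blocking argument
(`IsOneDependentNoise.tendsto_charFun_sum`) gives the long-run variance r(0) + 2 r(1). Subtracting
the two linearizations, the bootstrap difference is T^{-1/2} Σ (V_t - 1) e_t up to o(1). Given the
data this is a sum of i.i.d. variables with weights e_t/√T, whose squares sum to nearly r(0) and
whose maximum is small, with high probability. The multipliers are independent over time, so r(1)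
never appears.

For convergence in probability of the conditional laws, the weighted CLT is made uniform over
weights in bounded Lipschitz distance (`exists_forall_blDist_weighted_sum_lt`), the conditional law
is computed by freezing the data (`condDistrib_of_indepFun`), and the linearization costs a random
amount whose expectation tends to zero (`ae_blDist_condDistrib_le`). -/

/-- The inverse learning rate `(t + γ)^ρ`. -/
noncomputable def inverseRate (γ ρ : ℝ) (t : ℕ) : ℝ := ((t : ℝ) + γ) ^ ρ

/-! ### Growth of the inverse learning rate and a contraction recursion. -/

section InverseRate

variable {γ ρ : ℝ}

lemma learningRate_eq_inv (hγ : 0 < γ) (t : ℕ) : learningRate γ ρ t = (inverseRate γ ρ t)⁻¹ := by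
  rw [learningRate, inverseRate, Real.rpow_neg (by positivity)]

lemma inverseRate_pos (hγ : 0 < γ) (t : ℕ) : 0 < inverseRate γ ρ t := by
  unfold inverseRate; positivity

lemma inverseRate_le_succ (hγ : 0 < γ) (hρ : 0 ≤ ρ) (t : ℕ) :
    inverseRate γ ρ t ≤ inverseRate γ ρ (t + 1) := by
  unfold inverseRate
  apply Real.rpow_le_rpow (by positivity) _ hρ
  push_cast; linarith

lemma inverseRate_zero_le (hγ : 0 < γ) (hρ : 0 ≤ ρ) (t : ℕ) :
    inverseRate γ ρ 0 ≤ inverseRate γ ρ t :=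
  monotone_nat_of_le_succ (inverseRate_le_succ hγ hρ) (Nat.zero_le t)

lemma tendsto_natCast_add_const (γ : ℝ) : Tendsto (fun t : ℕ => (t : ℝ) + γ) atTop atTop :=
  tendsto_atTop_add_const_right _ _ tendsto_natCast_atTop_atTop

lemma tendsto_inverseRate (hρ : 0 < ρ) : Tendsto (inverseRate γ ρ) atTop atTop :=
  (tendsto_rpow_atTop hρ).comp (tendsto_natCast_add_const γ)

/-- Bernoulli's inequality for the exponent ρ ≤ 1, applied to (1 + 1/x)^ρ with x = t + γ. -/
lemma inverseRate_succ_sub_le (hγ : 0 < γ) (hρ0 : 0 ≤ ρ) (hρ1 : ρ ≤ 1) (t : ℕ) :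
    inverseRate γ ρ (t + 1) - inverseRate γ ρ t ≤ ρ * ((t : ℝ) + γ) ^ (-(1 - ρ)) := by
  unfold inverseRate
  set x : ℝ := t + γ with hx
  have hx0 : 0 < x := by positivity
  have h1 : ((t + 1 : ℕ) : ℝ) + γ = x * (1 + 1 / x) := by
    push_cast; field_simp; rw [hx]; ring
  rw [h1, Real.mul_rpow hx0.le (by positivity)]
  have h2 : (1 + 1 / x) ^ ρ ≤ 1 + ρ * (1 / x) :=
    rpow_one_add_le_one_add_mul_self (by have := one_div_pos.2 hx0; linarith) hρ0 hρ1
  have h3 : x ^ (-(1 - ρ)) = x ^ ρ / x := by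
    rw [neg_sub, Real.rpow_sub_one hx0.ne']
  have h4 : 0 ≤ x ^ ρ := by positivity
  rw [h3]
  calc x ^ ρ * (1 + 1 / x) ^ ρ - x ^ ρ ≤ x ^ ρ * (1 + ρ * (1 / x)) - x ^ ρ := by gcongr
    _ = ρ * (x ^ ρ / x) := by ring

lemma tendsto_inverseRate_succ_sub (hγ : 0 < γ) (hρ0 : 0 ≤ ρ) (hρ1 : ρ < 1) :
    Tendsto (fun t => inverseRate γ ρ (t + 1) - inverseRate γ ρ t) atTop (𝓝 0) := by
  have h : Tendsto (fun t : ℕ => ρ * ((t : ℝ) + γ) ^ (-(1 - ρ))) atTop (𝓝 0) := by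
    simpa using ((tendsto_rpow_neg_atTop (y := 1 - ρ) (by linarith)).comp
      (tendsto_natCast_add_const γ)).const_mul ρ
  exact squeeze_zero (fun t => sub_nonneg.2 (inverseRate_le_succ hγ hρ0 t))
    (inverseRate_succ_sub_le hγ hρ0 hρ1.le) h

lemma inverseRate_succ_le_mul (hγ : 0 < γ) (hρ0 : 0 ≤ ρ) (hρ1 : ρ ≤ 1) (t : ℕ) :
    inverseRate γ ρ (t + 1) ≤ (1 + 1 / γ) * inverseRate γ ρ t := by
  have h := inverseRate_succ_sub_le hγ hρ0 hρ1 t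
  have hx0 : 0 < (t : ℝ) + γ := by positivity
  have h3 : ((t : ℝ) + γ) ^ (-(1 - ρ)) = inverseRate γ ρ t / (t + γ) := by
    rw [neg_sub, Real.rpow_sub_one hx0.ne', inverseRate]
  have h4 := inverseRate_pos (ρ := ρ) hγ t
  have h5 : ρ * (inverseRate γ ρ t / (t + γ)) ≤ 1 * (inverseRate γ ρ t / γ) := by
    gcongr; linarith [(Nat.cast_nonneg t : (0 : ℝ) ≤ t)]
  rw [h3] at h
  calc inverseRate γ ρ (t + 1) ≤ inverseRate γ ρ t + 1 * (inverseRate γ ρ t / γ) := by linarith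
    _ = _ := by ring

/-- The increments vanish, so their Cesàro means do as well, and these telescope. -/
lemma tendsto_inverseRate_div (hγ : 0 < γ) (hρ0 : 0 ≤ ρ) (hρ1 : ρ < 1) :
    Tendsto (fun T : ℕ => inverseRate γ ρ T / T) atTop (𝓝 0) := by
  have h := (tendsto_inverseRate_succ_sub hγ hρ0 hρ1).cesaro
  simp_rw [Finset.sum_range_sub] at h
  have h2 : Tendsto (fun T : ℕ => inverseRate γ ρ 0 / (T : ℝ)) atTop (𝓝 0) :=
    tendsto_const_nhds.div_atTop tendsto_natCast_atTop_atTop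
  have := h.add h2
  rw [add_zero] at this
  refine this.congr fun T => ?_
  ring

/-- A sequence that contracts at rate `1 / a_t` up to an error of order `1 / a_t ^ 2` is of order
`1 / a_t`, provided that the increments of `a` vanish. -/
lemma exists_le_div_of_recursion {a x : ℕ → ℝ} (ha : ∀ t, 0 < a t) (hmono : ∀ t, a t ≤ a (t + 1))
    (hdiff : Tendsto (fun t => a (t + 1) - a t) atTop (𝓝 0)) (htop : Tendsto a atTop atTop)
    (hx : ∀ t, 0 ≤ x t) {C : ℝ} (hC : 0 ≤ C)
    (hrec : ∀ t, x (t + 1) ≤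
      (1 - 2 * (a (t + 1))⁻¹ + 2 * (a (t + 1))⁻¹ ^ 2) * x t + C * (a (t + 1))⁻¹ ^ 2) :
    ∃ C', 0 ≤ C' ∧ ∀ t, x t ≤ C' * (a t)⁻¹ := by
  obtain ⟨N, hN⟩ := ((hdiff.eventually_le_const (by norm_num : (0 : ℝ) < 1 / 2)).and
    (htop.eventually_ge_atTop 2)).exists_forall_of_atTop
  -- The sum covers t ≤ N. Beyond N half of the contraction survives the growth of `a`, leaving a
  -- margin C'/2 that must absorb C; hence the term 2C.
  set C' := 2 * C + ∑ t ∈ Finset.range (N + 1), x t * a t with hC'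
  have hnn : ∀ t, 0 ≤ x t * a t := fun t => mul_nonneg (hx t) (ha t).le
  have hsum : 0 ≤ ∑ t ∈ Finset.range (N + 1), x t * a t := Finset.sum_nonneg fun t _ => hnn t
  have hC'0 : 0 ≤ C' := by linarith
  have key : ∀ t, x t * a t ≤ C' := by
    have small : ∀ t ≤ N, x t * a t ≤ C' := fun t ht => by
      have := Finset.single_le_sum (fun t _ => hnn t) (Finset.mem_range.2 (Nat.lt_succ_of_le ht))
      linarith
    intro t
    rcases le_total t N with h | h
    · exact small t h
    · induction t, h using Nat.le_induction with
      | base => exact small N le_rfl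
      | succ t ht ih =>
        obtain ⟨h1, h2⟩ := hN t ht
        have hA := ha (t + 1)
        have hA2 : 2 ≤ a (t + 1) := h2.trans (hmono t)
        have hr := hrec t
        have hat := ha t
        have hm := hmono t
        set A := a (t + 1)
        set b := a t
        have hi : A * A⁻¹ = 1 := mul_inv_cancel₀ hA.ne'
        have h3 : x (t + 1) * A ≤ (A - 1) * x t + C * A⁻¹ := by
          have e1 : 2 * A⁻¹ ≤ 1 := by
            rw [← div_eq_mul_inv, div_le_one hA]; exact hA2
          calc x (t + 1) * A
              ≤ ((1 - 2 * A⁻¹ + 2 * A⁻¹ ^ 2) * x t + C * A⁻¹ ^ 2) * A := by gcongr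
            _ = (A - 2 + 2 * A⁻¹) * x t + C * A⁻¹ := by
              field_simp
            _ ≤ (A - 1) * x t + C * A⁻¹ := by
              have := hx t
              gcongr
              linarith
        have h4 : x t ≤ C' * b⁻¹ := by rw [← div_eq_mul_inv, le_div_iff₀ hat]; exact ih
        have h5 : (A - 1) * x t ≤ (A - 1) * (C' * b⁻¹) := by gcongr; linarith
        have h6 : C * A⁻¹ ≤ C * b⁻¹ := by gcongr
        have h7 : (A - 1) * (C' * b⁻¹) + C * b⁻¹ ≤ C' := by
          have : ((A - 1) * (C' * b⁻¹) + C * b⁻¹) = ((A - 1) * C' + C) / b := by ring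
          rw [this, div_le_iff₀ hat]
          nlinarith
        linarith
  refine ⟨C', hC'0, fun t => ?_⟩
  rw [← div_eq_mul_inv, le_div_iff₀ (ha t)]
  exact key t

end InverseRate

/-! ### Characteristic functions along null arrays. -/

section CharFun

/-- Exchange one factor at a time; the other factors have norm at most 1. -/
lemma norm_prod_sub_prod_le {ι : Type*} (s : Finset ι) (a b : ι → ℂ) (ha : ∀ i ∈ s, ‖a i‖ ≤ 1)
    (hb : ∀ i ∈ s, ‖b i‖ ≤ 1) :
    ‖∏ i ∈ s, a i - ∏ i ∈ s, b i‖ ≤ ∑ i ∈ s, ‖a i - b i‖ := by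
  classical
  induction s using Finset.induction with
  | empty => simp
  | insert i s hi ih =>
    rw [Finset.prod_insert hi, Finset.prod_insert hi, Finset.sum_insert hi]
    have h1 := ih (fun j hj => ha j (Finset.mem_insert_of_mem hj))
      (fun j hj => hb j (Finset.mem_insert_of_mem hj))
    have h2 : ‖∏ j ∈ s, b j‖ ≤ 1 := by
      rw [norm_prod]
      exact Finset.prod_le_one (fun _ _ => norm_nonneg _)
        (fun j hj => hb j (Finset.mem_insert_of_mem hj))
    have h3 := ha i (Finset.mem_insert_self i s)
    calc ‖a i * ∏ j ∈ s, a j - b i * ∏ j ∈ s, b j‖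
        = ‖(a i - b i) * ∏ j ∈ s, b j + a i * (∏ j ∈ s, a j - ∏ j ∈ s, b j)‖ := by ring_nf
      _ ≤ ‖a i - b i‖ * ‖∏ j ∈ s, b j‖ + ‖a i‖ * ‖∏ j ∈ s, a j - ∏ j ∈ s, b j‖ := by
        rw [← norm_mul, ← norm_mul]; exact norm_add_le _ _
      _ ≤ ‖a i - b i‖ * 1 + 1 * ∑ j ∈ s, ‖a j - b j‖ := by gcongr
      _ = _ := by ring

lemma taylor_charFun_two_of_integral_sq {Ω : Type*} [MeasurableSpace Ω] {P : Measure Ω}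
    [IsProbabilityMeasure P] {X : Ω → ℝ} (hX : MemLp X 2 P) (h0 : ∫ ω, X ω ∂P = 0) {v : ℝ}
    (h1 : ∫ ω, X ω ^ 2 ∂P = v) :
    (fun t : ℝ => charFun (P.map X) t - (1 - v * t ^ 2 / 2)) =o[𝓝 0] fun t : ℝ => t ^ 2 := by
  have hm := hX.aemeasurable
  have hid : MemLp id 2 (P.map X) := by
    rw [memLp_map_measure_iff (by fun_prop) hm]; exact hX
  have : IsProbabilityMeasure (P.map X) := Measure.isProbabilityMeasure_map hm
  have h := taylor_isLittleO_univ (x₀ := (0 : ℝ)) (contDiff_charFun (n := 2) hid)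
  simp_rw [taylorWithinEval_charFun_two_zero hm hid, sub_zero] at h
  simpa [h0, h1] using h

/-- Products of values of a function with the second order expansion `1 - v t ^ 2 / 2` along a
null array converge to the corresponding Gaussian value. -/
lemma tendsto_prod_of_taylor_two {ι : Type*} {l : Filter ι} {φ : ℝ → ℂ} {v : ℝ} (hv : 0 ≤ v)
    (hφ : (fun t : ℝ => φ t - (1 - v * t ^ 2 / 2)) =o[𝓝 0] fun t : ℝ => t ^ 2)
    (hφ1 : ∀ t, ‖φ t‖ ≤ 1) {n : ι → ℕ} {u : ι → ℕ → ℝ} {r : ℝ}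
    (hu : Tendsto (fun k => ∑ i ∈ Finset.range (n k), u k i ^ 2) l (𝓝 r))
    (hmax : ∀ δ > 0, ∀ᶠ k in l, ∀ i < n k, |u k i| < δ) :
    Tendsto (fun k => ∏ i ∈ Finset.range (n k), φ (u k i)) l
      (𝓝 (Complex.exp (-(v * r / 2 : ℝ)))) := by
  -- Lindeberg-style comparison: ψ is the Gaussian characteristic function with the same expansion,
  -- its products are explicit, and the difference of the two products is a sum of o(u²) terms.
  set ψ : ℝ → ℂ := fun t => Complex.exp (-(v * t ^ 2 / 2 : ℝ)) with hψ
  have hψ' : (fun t : ℝ => ψ t - (1 - v * t ^ 2 / 2)) =o[𝓝 0] fun t : ℝ => t ^ 2 := by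
    have h := taylor_charFun_two_of_integral_sq (P := gaussianReal 0 v.toNNReal) (X := id)
      (v := v) (memLp_id_gaussianReal 2) (by simp [integral_id_gaussianReal]) (by
        have := variance_id_gaussianReal (μ := 0) (v := v.toNNReal)
        rw [variance_of_integral_eq_zero (by fun_prop)
          (by simp [integral_id_gaussianReal])] at this
        simpa [hv] using this)
    refine h.congr_left fun t => ?_
    simp only [Measure.map_id, charFun_gaussianReal, hψ]
    congr 2
    simp [hv]
  have hd : (fun t => φ t - ψ t) =o[𝓝 0] fun t : ℝ => t ^ 2 :=
    (hφ.sub hψ').congr_left fun t => by ring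
  have hψ1 : ∀ t, ‖ψ t‖ ≤ 1 := fun t => by
    rw [hψ]
    simp only
    rw [← Complex.ofReal_neg, Complex.norm_exp_ofReal, Real.exp_le_one_iff]
    have : 0 ≤ v * t ^ 2 / 2 := by positivity
    linarith
  have h1 : Tendsto (fun k => ∏ i ∈ Finset.range (n k), ψ (u k i)) l
      (𝓝 (Complex.exp (-(v * r / 2 : ℝ)))) := by
    simp_rw [hψ, ← Complex.exp_sum]
    refine (Complex.continuous_exp.tendsto _).comp ?_
    simp_rw [← Complex.ofReal_neg, ← Complex.ofReal_sum]
    refine (Complex.continuous_ofReal.tendsto _).comp ?_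
    have := (hu.const_mul (v / 2)).neg
    convert this using 2 with k
    · rw [Finset.mul_sum, ← Finset.sum_neg_distrib]
      exact Finset.sum_congr rfl fun i _ => by ring
    · ring
  have h2 : Tendsto (fun k => ∏ i ∈ Finset.range (n k), φ (u k i)
      - ∏ i ∈ Finset.range (n k), ψ (u k i)) l (𝓝 0) := by
    rw [Metric.tendsto_nhds]
    intro ε hε
    have hr1 : 0 < |r| + 1 := by positivity
    have hε' : 0 < ε / (|r| + 1) := by positivity
    have hdε := hd.def (half_pos hε')
    obtain ⟨δ, hδ, hball⟩ := Metric.eventually_nhds_iff.1 hdε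
    filter_upwards [hmax δ hδ, hu.eventually_lt_const
      (lt_of_le_of_lt (le_abs_self r) (lt_add_one _))] with k hk1 hk2
    rw [dist_zero_right]
    calc ‖∏ i ∈ Finset.range (n k), φ (u k i) - ∏ i ∈ Finset.range (n k), ψ (u k i)‖
        ≤ ∑ i ∈ Finset.range (n k), ‖φ (u k i) - ψ (u k i)‖ :=
          norm_prod_sub_prod_le _ _ _ (fun _ _ => hφ1 _) (fun _ _ => hψ1 _)
      _ ≤ ∑ i ∈ Finset.range (n k), ε / (|r| + 1) / 2 * u k i ^ 2 := by
        refine Finset.sum_le_sum fun i hi => ?_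
        have := hball (y := u k i) (by simpa using hk1 i (Finset.mem_range.1 hi))
        simpa using this
      _ = ε / (|r| + 1) / 2 * ∑ i ∈ Finset.range (n k), u k i ^ 2 := by rw [Finset.mul_sum]
      _ ≤ ε / (|r| + 1) / 2 * (|r| + 1) := by gcongr
      _ = ε / 2 := by field_simp
      _ < ε := half_lt_self hε
  simpa using h2.add h1

end CharFun

/-! ### Bounded Lipschitz distance and weak convergence. -/

section BoundedLipschitz

/-- The bounded Lipschitz distance of two measures on `ℝ`. -/
noncomputable def blDist (μ ν : Measure ℝ) : ℝ :=
  ⨆ f : BL1, |∫ x, (f : ℝ → ℝ) x ∂μ - ∫ x, (f : ℝ → ℝ) x ∂ν|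

lemma BL1_nonempty : Nonempty BL1 := ⟨⟨fun _ => 0, by simp [BL1]⟩⟩

lemma continuous_of_mem_BL1 {f : ℝ → ℝ} (hf : f ∈ BL1) : Continuous f :=
  (LipschitzWith.of_dist_le_mul (K := 1) fun x y => by
    simpa [Real.dist_eq] using hf.2 x y).continuous

lemma integrable_comp_of_mem_BL1 {Ω : Type*} [MeasurableSpace Ω] {P : Measure Ω}
    [IsFiniteMeasure P] {f : ℝ → ℝ} (hf : f ∈ BL1) {X : Ω → ℝ} (hX : AEMeasurable X P) :
    Integrable (fun ω => f (X ω)) P :=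
  Integrable.of_bound
    ((continuous_of_mem_BL1 hf).measurable.comp_aemeasurable hX).aestronglyMeasurable
    1 (ae_of_all _ fun _ => hf.1 _)

lemma blDist_le {μ ν : Measure ℝ} {c : ℝ}
    (h : ∀ f ∈ BL1, |∫ x, f x ∂μ - ∫ x, f x ∂ν| ≤ c) : blDist μ ν ≤ c := by
  have := BL1_nonempty
  exact ciSup_le fun f => h f f.2

lemma blDist_nonneg (μ ν : Measure ℝ) : 0 ≤ blDist μ ν :=
  Real.iSup_nonneg fun _ => abs_nonneg _

/-- The bound 2 shows that the supremum is over a bounded set, so that it is a true supremum and not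
the default value 0. -/
lemma abs_integral_sub_le_blDist {μ ν : Measure ℝ} [IsProbabilityMeasure μ]
    [IsProbabilityMeasure ν] {f : ℝ → ℝ} (hf : f ∈ BL1) :
    |∫ x, f x ∂μ - ∫ x, f x ∂ν| ≤ blDist μ ν := by
  refine le_ciSup (f := fun f : BL1 => |∫ x, (f : ℝ → ℝ) x ∂μ - ∫ x, (f : ℝ → ℝ) x ∂ν|)
    ⟨2, ?_⟩ ⟨f, hf⟩
  rintro _ ⟨g, rfl⟩
  have h (κ : Measure ℝ) [IsProbabilityMeasure κ] : |∫ x, (g : ℝ → ℝ) x ∂κ| ≤ 1 := by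
    have := norm_integral_le_of_norm_le_const (μ := κ) (f := (g : ℝ → ℝ)) (C := 1)
      (ae_of_all _ fun x => g.2.1 x)
    simpa using this
  have h1 := h μ
  have h2 := h ν
  calc _ ≤ |∫ x, (g : ℝ → ℝ) x ∂μ| + |∫ x, (g : ℝ → ℝ) x ∂ν| := abs_sub _ _
    _ ≤ 2 := by linarith

lemma blDist_triangle (μ ν κ : Measure ℝ) [IsProbabilityMeasure μ] [IsProbabilityMeasure ν]
    [IsProbabilityMeasure κ] : blDist μ κ ≤ blDist μ ν + blDist ν κ :=
  blDist_le fun f hf => (abs_sub_le _ (∫ x, f x ∂ν) _).trans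
    (add_le_add (abs_integral_sub_le_blDist hf) (abs_integral_sub_le_blDist hf))

lemma blDist_map_le_integral_abs_sub {Ω : Type*} [MeasurableSpace Ω] {P : Measure Ω}
    [IsProbabilityMeasure P] {X Z : Ω → ℝ} (hX : AEMeasurable X P) (hZ : AEMeasurable Z P)
    (hXZ : Integrable (fun ω => X ω - Z ω) P) :
    blDist (P.map X) (P.map Z) ≤ ∫ ω, |X ω - Z ω| ∂P := by
  refine blDist_le fun f hf => ?_
  have hfm := (continuous_of_mem_BL1 hf).measurable
  rw [integral_map hX hfm.aestronglyMeasurable, integral_map hZ hfm.aestronglyMeasurable,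
    ← integral_sub (integrable_comp_of_mem_BL1 hf hX) (integrable_comp_of_mem_BL1 hf hZ)]
  exact (abs_integral_le_integral_abs).trans
    (integral_mono ((integrable_comp_of_mem_BL1 hf hX).sub (integrable_comp_of_mem_BL1 hf hZ)).abs
      hXZ.abs fun ω => hf.2 _ _)

/-- Layer cake for f + 1 ≥ 0: since f is 1-Lipschitz, the ε-thickening of a superlevel set of f lies
in the corresponding superlevel set of f + ε. This shift costs ε, and the Lévy–Prokhorov error ε‖f +
1‖ costs at most 2ε. -/
lemma integral_le_add_of_levyProkhorovEDist_lt {μ ν : Measure ℝ} [IsProbabilityMeasure μ]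
    [IsProbabilityMeasure ν] {ε : ℝ} (hε : 0 < ε)
    (h : levyProkhorovEDist μ ν < ENNReal.ofReal ε) {f : ℝ → ℝ} (hf : f ∈ BL1) :
    ∫ x, f x ∂μ ≤ ∫ x, f x ∂ν + 3 * ε := by
  have hcont := continuous_of_mem_BL1 hf
  have hbd : ∀ c : ℝ, 0 ≤ c → ∀ x, ‖f x + 1 + c‖ ≤ 2 + c := fun c hc x => by
    have := abs_le.1 (hf.1 x)
    rw [Real.norm_eq_abs, abs_le]; constructor <;> linarith
  let g (c : ℝ) (hc : 0 ≤ c) : BoundedContinuousFunction ℝ ℝ :=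
    BoundedContinuousFunction.ofNormedAddCommGroup (fun x => f x + 1 + c) (by fun_prop) (2 + c)
      (hbd c hc)
  have hgnn (c : ℝ) (hc : 0 ≤ c) (x : ℝ) : 0 ≤ g c hc x := by
    have := abs_le.1 (hf.1 x)
    change 0 ≤ f x + 1 + c
    linarith
  have hint (κ : Measure ℝ) [IsProbabilityMeasure κ] (c : ℝ) (hc : 0 ≤ c) :
      ∫ x, g c hc x ∂κ = ∫ x, f x ∂κ + 1 + c := by
    change ∫ x, (f x + 1 + c) ∂κ = _
    have hi : Integrable f κ := integrable_comp_of_mem_BL1 hf (X := id) aemeasurable_id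
    have e1 := integral_add (f := fun x => f x + 1) (hi.add (integrable_const (1 : ℝ)))
      (integrable_const c)
    have e2 := integral_add hi (integrable_const (1 : ℝ))
    simp only [integral_const, probReal_univ, one_smul] at e1 e2
    rw [e1, e2]
  have h1 := BoundedContinuousFunction.integral_le_of_levyProkhorovEDist_lt μ ν hε h (g 0 le_rfl)
    (ae_of_all _ (hgnn 0 le_rfl))
  have hnorm : ‖g 0 le_rfl‖ ≤ 2 := by
    refine (BoundedContinuousFunction.norm_le (by norm_num)).2 fun x => ?_
    have h2 : ‖f x + 1 + 0‖ ≤ 2 + 0 := hbd 0 le_rfl x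
    rw [add_zero (2 : ℝ)] at h2
    exact h2
  have hle : ‖g 0 le_rfl‖ ≤ ‖g ε hε.le‖ := by
    refine (BoundedContinuousFunction.norm_le (norm_nonneg _)).2 fun x => ?_
    refine le_trans ?_ (BoundedContinuousFunction.norm_coe_le_norm (g ε hε.le) x)
    rw [Real.norm_of_nonneg (hgnn 0 le_rfl x), Real.norm_of_nonneg (hgnn ε hε.le x)]
    change f x + 1 + 0 ≤ f x + 1 + ε
    linarith
  have hmeas : ∀ s : ℝ → Set ℝ, Antitone s → ∀ R : ℝ,
      IntegrableOn (fun t => ν.real (s t)) (Set.Ioc 0 R) := fun s hs R => by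
    apply Measure.integrableOn_of_bounded (M := 1) measure_Ioc_lt_top.ne
    · exact (Measurable.ennreal_toReal (Antitone.measurable fun _ _ hst =>
        measure_mono (hs hst))).aestronglyMeasurable
    · refine ae_of_all _ fun t => ?_
      rw [Real.norm_of_nonneg measureReal_nonneg]
      exact measureReal_le_one
  have hanti : Antitone fun t => {a | t ≤ g ε hε.le a} := fun _ _ hst _ h => le_trans hst h
  have hanti0 : Antitone fun t => Metric.thickening ε {a | t ≤ g 0 le_rfl a} := fun _ _ hst =>
    Metric.thickening_subset_of_subset ε (fun _ h => le_trans hst h)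
  have h2 : ∫ t in Set.Ioc 0 ‖g 0 le_rfl‖, ν.real (Metric.thickening ε {a | t ≤ g 0 le_rfl a})
      ≤ ∫ x, g ε hε.le x ∂ν := by
    rw [BoundedContinuousFunction.integral_eq_integral_meas_le (g ε hε.le) ν
      (ae_of_all _ (hgnn ε hε.le))]
    calc _ ≤ ∫ t in Set.Ioc 0 ‖g 0 le_rfl‖, ν.real {a | t ≤ g ε hε.le a} := by
          refine setIntegral_mono (hmeas _ hanti0 _) (hmeas _ hanti _) fun t => ?_
          refine measureReal_mono fun a ha => ?_
          obtain ⟨b, hb, hab⟩ := Metric.mem_thickening_iff.1 ha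
          have hb' : t ≤ f b + 1 + 0 := hb
          have h3 := (abs_le.1 (hf.2 a b)).1
          rw [Real.dist_eq] at hab
          change t ≤ f a + 1 + ε
          linarith
      _ ≤ _ := setIntegral_mono_set (hmeas _ hanti _)
          (ae_of_all _ fun t => measureReal_nonneg)
          (LE.le.eventuallyLE (Set.Ioc_subset_Ioc_right hle))
  rw [hint μ 0 le_rfl] at h1
  rw [hint ν ε hε.le] at h2
  nlinarith

/-- Weak convergence implies convergence in bounded Lipschitz distance. -/
lemma tendsto_blDist_of_tendsto {ι : Type*} {l : Filter ι} {μ : ι → ProbabilityMeasure ℝ}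
    {ν : ProbabilityMeasure ℝ} (h : Tendsto μ l (𝓝 ν)) :
    Tendsto (fun i => blDist (μ i) ν) l (𝓝 0) := by
  have h1 := (LevyProkhorov.continuous_ofMeasure_probabilityMeasure.tendsto ν).comp h
  rw [EMetric.tendsto_nhds] at h1
  rw [Metric.tendsto_nhds]
  intro ε hε
  filter_upwards [h1 (ENNReal.ofReal (ε / 4)) (by simpa using by linarith)] with i hi
  have hi' : levyProkhorovEDist (μ i : Measure ℝ) ν < ENNReal.ofReal (ε / 4) := hi
  have hi'' : levyProkhorovEDist (ν : Measure ℝ) (μ i) < ENNReal.ofReal (ε / 4) := by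
    rwa [levyProkhorovEDist_comm]
  rw [dist_zero_right, Real.norm_of_nonneg (blDist_nonneg _ _)]
  refine lt_of_le_of_lt (blDist_le (c := 3 * (ε / 4)) fun f hf => ?_) (by linarith)
  have h2 := integral_le_add_of_levyProkhorovEDist_lt (by linarith) hi' hf
  have h3 := integral_le_add_of_levyProkhorovEDist_lt (by linarith) hi'' hf
  rw [abs_le]; constructor <;> linarith

end BoundedLipschitz

/-! ### Central limit theorem for weighted i.i.d. sums. -/

section WeightedCLT

variable {Ω : Type*} [MeasurableSpace Ω] {P : Measure Ω}

lemma charFun_map_weighted_sum {Z : ℕ → Ω → ℝ} (hZ : ∀ i, AEMeasurable (Z i) P)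
    (hindep : iIndepFun Z P) (hident : ∀ i, IdentDistrib (Z i) (Z 0) P P) (n : ℕ) (u : ℕ → ℝ)
    (t : ℝ) :
    charFun (P.map fun ω => ∑ i ∈ Finset.range n, u i * Z i ω) t =
      ∏ i ∈ Finset.range n, charFun (P.map (Z 0)) (u i * t) := by
  have h : iIndepFun (fun i ω => u i * Z i ω) P :=
    hindep.comp (fun i x => u i * x) fun i => by fun_prop
  rw [(h.restrict _).charFun_map_fun_finsetSum_eq_prod fun i _ => (hZ i).const_mul _,
    Finset.prod_apply]
  refine Finset.prod_congr rfl fun i _ => ?_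
  rw [charFun_map_mul_comp (hZ i), (hident i).map_eq]

/-- Weighted sums of i.i.d. standardised variables along a null array of weights with converging
sum of squares are asymptotically normal. -/
lemma tendsto_weighted_sum [IsProbabilityMeasure P] {Z : ℕ → Ω → ℝ} (hZ : ∀ i, MemLp (Z i) 2 P)
    (hindep : iIndepFun Z P) (hident : ∀ i, IdentDistrib (Z i) (Z 0) P P)
    (h0 : ∫ ω, Z 0 ω ∂P = 0) (h1 : ∫ ω, Z 0 ω ^ 2 ∂P = 1) {n : ℕ → ℕ} {u : ℕ → ℕ → ℝ} {r : ℝ}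
    (hr : 0 ≤ r) (hu : Tendsto (fun k => ∑ i ∈ Finset.range (n k), u k i ^ 2) atTop (𝓝 r))
    (hmax : ∀ δ > 0, ∀ᶠ k in atTop, ∀ i < n k, |u k i| < δ) :
    Tendsto (fun k => blDist (P.map fun ω => ∑ i ∈ Finset.range (n k), u k i * Z i ω)
      (gaussianReal 0 r.toNNReal)) atTop (𝓝 0) := by
  have hm (k : ℕ) : AEMeasurable (fun ω => ∑ i ∈ Finset.range (n k), u k i * Z i ω) P :=
    Finset.aemeasurable_fun_sum _ fun i _ => (hZ i).aemeasurable.const_mul _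
  let μs (k : ℕ) : ProbabilityMeasure ℝ :=
    ⟨_, Measure.isProbabilityMeasure_map (hm k)⟩
  let ν : ProbabilityMeasure ℝ := ⟨gaussianReal 0 r.toNNReal, inferInstance⟩
  refine tendsto_blDist_of_tendsto (μ := μs) (ν := ν)
    (ProbabilityMeasure.tendsto_of_tendsto_charFun fun t => ?_)
  have : IsProbabilityMeasure (P.map (Z 0)) :=
    Measure.isProbabilityMeasure_map (hZ 0).aemeasurable
  have key := tendsto_prod_of_taylor_two (v := 1) zero_le_one
    (taylor_charFun_two_of_integral_sq (hZ 0) h0 h1) (fun t => norm_charFun_le_one t)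
    (u := fun k i => u k i * t) (n := n) (r := r * t ^ 2) (l := atTop) (by
      simpa [mul_pow, Finset.sum_mul] using hu.mul_const (t ^ 2)) (fun δ hδ => by
      filter_upwards [hmax (δ / (|t| + 1)) (by positivity)] with k hk i hi
      have h2 := hk i hi
      have h3 : 0 < |t| + 1 := by positivity
      rw [lt_div_iff₀ h3] at h2
      rw [abs_mul]
      nlinarith [abs_nonneg (u k i), abs_nonneg t])
  have e1 (k : ℕ) : charFun (μs k : Measure ℝ) t =
      ∏ i ∈ Finset.range (n k), charFun (P.map (Z 0)) (u k i * t) :=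
    charFun_map_weighted_sum (fun i => (hZ i).aemeasurable) hindep hident (n k) (u k) t
  have e2 : charFun (ν : Measure ℝ) t = Complex.exp (-(1 * (r * t ^ 2) / 2 : ℝ)) := by
    change charFun (gaussianReal 0 r.toNNReal) t = _
    rw [charFun_gaussianReal]
    congr 1
    simp [hr]
  simp_rw [e1, e2]
  exact key

/-- The weighted central limit theorem, uniformly over arrays of weights. -/
lemma exists_forall_blDist_weighted_sum_lt [IsProbabilityMeasure P] {Z : ℕ → Ω → ℝ}
    (hZ : ∀ i, MemLp (Z i) 2 P)
    (hindep : iIndepFun Z P) (hident : ∀ i, IdentDistrib (Z i) (Z 0) P P)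
    (h0 : ∫ ω, Z 0 ω ∂P = 0) (h1 : ∫ ω, Z 0 ω ^ 2 ∂P = 1) {r : ℝ} (hr : 0 ≤ r) {ε : ℝ}
    (hε : 0 < ε) :
    ∃ δ > 0, ∀ (n : ℕ) (u : ℕ → ℝ), |∑ i ∈ Finset.range n, u i ^ 2 - r| < δ →
      (∀ i < n, |u i| < δ) →
      blDist (P.map fun ω => ∑ i ∈ Finset.range n, u i * Z i ω) (gaussianReal 0 r.toNNReal)
        < ε := by
  -- Counterexamples for δ = 1/(k + 1) would form a null array contradicting `tendsto_weighted_sum`.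
  by_contra! hcon
  choose n u hu hmax hbl using fun k : ℕ => hcon (1 / ((k : ℝ) + 1)) (by positivity)
  have hlim := tendsto_weighted_sum hZ hindep hident h0 h1 hr (n := n) (u := u)
    (by
      rw [tendsto_iff_dist_tendsto_zero]
      exact squeeze_zero (fun _ => dist_nonneg) (fun k => (hu k).le)
        tendsto_one_div_add_atTop_nhds_zero_nat)
    (fun δ hδ => by
      filter_upwards [tendsto_one_div_add_atTop_nhds_zero_nat.eventually_lt_const hδ] with k hk i hi
      exact (hmax k i hi).trans hk)
  obtain ⟨k, hk⟩ := (hlim.eventually_lt_const hε).exists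
  exact absurd (hbl k) (not_le.2 hk)

end WeightedCLT

/-! ### Independence structure of noise and weights. -/

section Independence

variable {Ω : Type*} [MeasurableSpace Ω] {μ : Measure Ω}

/-- The two hypotheses factor the joint law into three marginals; the claim is the other bracketing
of that product. -/
lemma indepFun_prodMk_of_indepFun {α β γ : Type*} [MeasurableSpace α] [MeasurableSpace β]
    [MeasurableSpace γ] [IsProbabilityMeasure μ] {A : Ω → α} {B : Ω → β} {C : Ω → γ}
    (hA : Measurable A) (hB : Measurable B) (hC : Measurable C)
    (h1 : IndepFun A (fun ω => (B ω, C ω)) μ) (h2 : IndepFun B C μ) :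
    IndepFun (fun ω => (A ω, B ω)) C μ := by
  have hAB : IndepFun A B μ := h1.comp (φ := id) (ψ := Prod.fst) measurable_id measurable_fst
  have i1 : IsProbabilityMeasure (μ.map A) := Measure.isProbabilityMeasure_map hA.aemeasurable
  have i2 : IsProbabilityMeasure (μ.map B) := Measure.isProbabilityMeasure_map hB.aemeasurable
  have i3 : IsProbabilityMeasure (μ.map C) := Measure.isProbabilityMeasure_map hC.aemeasurable
  rw [indepFun_iff_map_prod_eq_prod_map_map (by fun_prop) (by fun_prop)] at h1 h2 hAB ⊢
  rw [hAB]
  apply (MeasurableEquiv.prodAssoc (α := α) (β := β) (γ := γ)).map_measurableEquiv_injective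
  rw [Measure.prodAssoc_prod, ← h2, ← h1, Measure.map_map (by fun_prop) (by fun_prop)]
  rfl

/-- The sequence that agrees with `x` before time `t` and vanishes from then on. -/
def truncateSeq (t : ℕ) (x : ℕ → ℝ) : ℕ → ℝ := fun i => if i < t then x i else 0

lemma truncateSeq_of_lt {t i : ℕ} (h : i < t) (x : ℕ → ℝ) : truncateSeq t x i = x i := if_pos h

@[fun_prop]
lemma measurable_truncateSeq (t : ℕ) : Measurable (truncateSeq t) := by
  refine measurable_pi_lambda _ fun i => ?_
  unfold truncateSeq
  split_ifs <;> fun_prop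

/-- A square integrable, centred, stationary, `1`-dependent sequence with autocovariances `r0`
and `r1` at lags zero and one. -/
structure IsOneDependentNoise (e : ℕ → Ω → ℝ) (r0 r1 : ℝ) (μ : Measure Ω) : Prop where
  measurable : ∀ t, Measurable (e t)
  memLp : ∀ t, MemLp (e t) 2 μ
  mean : ∀ t, ∫ ω, e t ω ∂μ = 0
  sq : ∀ t, ∫ ω, e t ω ^ 2 ∂μ = r0
  cov : ∀ t, ∫ ω, e t ω * e (t + 1) ω ∂μ = r1
  indep : ∀ t, IndepFun (fun ω => truncateSeq t (fun i => e i ω)) (fun ω i => e (t + 1 + i) ω) μ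
  stationary : IsStationarySeq e μ

/-- Random weights of mean one and second moment `m`, each independent of the past weights and of
the noise. -/
structure IsWeightSequence (W e : ℕ → Ω → ℝ) (m : ℝ) (μ : Measure Ω) : Prop where
  measurable : ∀ t, Measurable (W t)
  memLp : ∀ t, MemLp (W t) 2 μ
  mean : ∀ t, ∫ ω, W t ω ∂μ = 1
  sq : ∀ t, ∫ ω, W t ω ^ 2 ∂μ = m
  indep_past : ∀ t, IndepFun (W t) (fun ω => (truncateSeq t (fun i => W i ω), fun i => e i ω)) μ
  indep_noise : IndepFun (fun ω i => W i ω) (fun ω i => e i ω) μ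

lemma IsMDependent.indepFun_truncateSeq [IsProbabilityMeasure μ] {e : ℕ → Ω → ℝ}
    (h : IsMDependent 1 e μ) (t : ℕ) :
    IndepFun (fun ω => truncateSeq t (fun i => e i ω)) (fun ω i => e (t + 1 + i) ω) μ := by
  rcases t with _ | s
  · have : (fun ω => truncateSeq 0 (fun i => e i ω)) = fun _ => fun _ => 0 := by
      ext ω i; simp [truncateSeq]
    rw [this]
    exact indepFun_const_left _ _
  · have h1 := (h s).comp
      (φ := fun x : Set.Iic s → ℝ => fun i => if hi : i ≤ s then x ⟨i, hi⟩ else 0)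
      (ψ := fun x : Set.Ioi (s + 1) → ℝ => fun i : ℕ =>
        x ⟨s + 1 + 1 + i, by simp only [Set.mem_Ioi]; omega⟩)
      (measurable_pi_lambda _ fun i => by split_ifs <;> fun_prop)
      (measurable_pi_lambda _ fun i => by fun_prop)
    convert h1 using 1
    · ext ω i
      simp [truncateSeq]
    · rfl

lemma IsMDependent.sub_const {Y : ℕ → Ω → ℝ} {m : ℕ} (h : IsMDependent m Y μ) (c : ℝ) :
    IsMDependent m (fun t ω => Y t ω - c) μ := fun s =>
  (h s).comp (φ := fun x i => x i - c) (ψ := fun x i => x i - c) (by fun_prop) (by fun_prop)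

lemma IsStationarySeq.sub_const {Y : ℕ → Ω → ℝ} (h : IsStationarySeq Y μ) (c : ℝ) :
    IsStationarySeq (fun t ω => Y t ω - c) μ := fun k =>
  (h k).comp (u := fun x i => x i - c) (by fun_prop)

lemma isOneDependentNoise_sub_const [IsProbabilityMeasure μ] {Y : ℕ → Ω → ℝ} {c r0 r1 : ℝ}
    (hYmeas : ∀ t, Measurable (Y t)) (hYL2 : ∀ t, MemLp (Y t) 2 μ)
    (hYstat : IsStationarySeq Y μ) (hYdep : IsMDependent 1 Y μ)
    (hYmean : ∀ t, ∫ ω, Y t ω ∂μ = c) (hr0 : ∀ t, ∫ ω, (Y t ω - c) ^ 2 ∂μ = r0)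
    (hr1 : ∀ t, ∫ ω, (Y t ω - c) * (Y (t + 1) ω - c) ∂μ = r1) :
    IsOneDependentNoise (fun t ω => Y t ω - c) r0 r1 μ where
  measurable t := (hYmeas t).sub_const c
  memLp t := (hYL2 t).sub (memLp_const c)
  mean t := by
    rw [integral_sub ((hYL2 t).integrable (by norm_num)) (integrable_const c), hYmean]
    simp
  sq := hr0
  cov := hr1
  indep := (hYdep.sub_const c).indepFun_truncateSeq
  stationary := hYstat.sub_const c

/-- Plain SGD becomes the case m = 1 of the bootstrap analysis. -/
lemma isWeightSequence_one [IsProbabilityMeasure μ] (e : ℕ → Ω → ℝ) :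
    IsWeightSequence (fun _ _ => 1) e 1 μ where
  measurable _ := measurable_const
  memLp _ := memLp_const 1
  mean _ := by simp
  sq _ := by simp
  indep_past _ := indepFun_const_left _ _
  indep_noise := indepFun_const_left _ _

lemma iIndepFun.indepFun_truncateSeq {V : ℕ → Ω → ℝ} (h : iIndepFun V μ)
    (hV : ∀ t, Measurable (V t)) (t : ℕ) :
    IndepFun (truncateSeq t ∘ fun ω i => V i ω) (V t) μ := by
  have h1 : IndepFun _ (V t) μ := (h.indepFun_finset (Finset.range t) {t} (by simp) hV).comp
    (φ := fun x i => if hi : i ∈ Finset.range t then x ⟨i, hi⟩ else 0)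
    (ψ := fun x => x ⟨t, Finset.mem_singleton_self t⟩)
    (measurable_pi_lambda _ fun i => by split_ifs <;> fun_prop) (measurable_pi_apply _)
  convert h1 using 1
  ext ω i
  simp [truncateSeq]

lemma isWeightSequence_of_iIndepFun [IsProbabilityMeasure μ] {V e : ℕ → Ω → ℝ} {m : ℝ}
    (hVmeas : ∀ t, Measurable (V t)) (hVL2 : ∀ t, MemLp (V t) 2 μ) (hVindep : iIndepFun V μ)
    (hVmean : ∀ t, ∫ ω, V t ω ∂μ = 1) (hVsq : ∀ t, ∫ ω, V t ω ^ 2 ∂μ = m)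
    (he : ∀ t, Measurable (e t)) (hVe : IndepFun (fun ω t => V t ω) (fun ω t => e t ω) μ) :
    IsWeightSequence V e m μ where
  measurable := hVmeas
  memLp := hVL2
  mean := hVmean
  sq := hVsq
  indep_noise := hVe
  indep_past t := by
    have hVm : Measurable fun ω t => V t ω := measurable_pi_lambda _ hVmeas
    have h1 : IndepFun (fun ω t => e t ω)
        (fun ω => ((truncateSeq t ∘ fun ω i => V i ω) ω, V t ω)) μ :=
      (hVe.comp (φ := fun v => (truncateSeq t v, v t)) (by fun_prop) measurable_id).symm
    -- The triple is the noise, the past weights and the present weight.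
    have h2 := indepFun_prodMk_of_indepFun (measurable_pi_lambda _ he)
      ((measurable_truncateSeq t).comp hVm) (hVmeas t) h1
      (iIndepFun.indepFun_truncateSeq hVindep hVmeas t)
    exact (h2.comp (φ := Prod.swap) (by fun_prop) measurable_id).symm

end Independence

/-! ### Algebra of the recursion. -/

section Recursion

variable {γ ρ : ℝ}

/-- This is adaptedness: it allows the inputs to be truncated at time t, and so turns independence
of the past into independence of the iterates. -/
lemma bootstrapSgdMean_congr {θ : ℝ} {v v' y y' : ℕ → ℝ} {t : ℕ} (hv : ∀ i < t, v i = v' i)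
    (hy : ∀ i < t, y i = y' i) : bootstrapSgdMean γ ρ θ v y t = bootstrapSgdMean γ ρ θ v' y' t := by
  induction t with
  | zero => rfl
  | succ t ih =>
    simp only [bootstrapSgdMean]
    rw [ih (fun i hi => hv i (hi.trans t.lt_succ_self)) fun i hi => hy i (hi.trans t.lt_succ_self),
      hv t t.lt_succ_self, hy t t.lt_succ_self]

lemma sgdMean_eq_bootstrapSgdMean (θ : ℝ) (y : ℕ → ℝ) (t : ℕ) :
    sgdMean γ ρ θ y t = bootstrapSgdMean γ ρ θ (fun _ => 1) y t := by
  induction t with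
  | zero => rfl
  | succ t ih => simp only [bootstrapSgdMean, sgdMean, ih, mul_one]

lemma bootstrapSgdMean_sub_const (θ c : ℝ) (v y : ℕ → ℝ) (t : ℕ) :
    bootstrapSgdMean γ ρ (θ - c) v (fun i => y i - c) t = bootstrapSgdMean γ ρ θ v y t - c := by
  induction t with
  | zero => rfl
  | succ t ih => simp only [bootstrapSgdMean, ih]; ring

@[fun_prop]
lemma measurable_bootstrapSgdMean (θ : ℝ) (t : ℕ) :
    Measurable fun p : (ℕ → ℝ) × (ℕ → ℝ) => bootstrapSgdMean γ ρ θ p.1 p.2 t := by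
  induction t with
  | zero => exact measurable_const
  | succ t ih => simp only [bootstrapSgdMean]; fun_prop

/-- The sum of the first `T` iterates is the weighted sum of the noise up to a martingale term and
terms produced by summation by parts. -/
lemma sum_bootstrapSgdMean_sub (hγ : 0 < γ) (θ : ℝ) (v y : ℕ → ℝ) (T : ℕ) :
    ∑ t ∈ Finset.Icc 1 T, bootstrapSgdMean γ ρ θ v y t - ∑ t ∈ Finset.range T, v t * y t =
      (1 - inverseRate γ ρ T) * bootstrapSgdMean γ ρ θ v y T - (1 - inverseRate γ ρ 0) * θ
      - ∑ t ∈ Finset.range T, (v t - 1) * bootstrapSgdMean γ ρ θ v y t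
      + ∑ t ∈ Finset.range T,
        (inverseRate γ ρ (t + 1) - inverseRate γ ρ t) * bootstrapSgdMean γ ρ θ v y t := by
  induction T with
  | zero => simp [bootstrapSgdMean]
  | succ T ih =>
    rw [Finset.sum_Icc_succ_top (by omega), Finset.sum_range_succ, Finset.sum_range_succ,
      Finset.sum_range_succ]
    have ha := (inverseRate_pos (ρ := ρ) hγ (T + 1)).ne'
    -- The recursion multiplied by the inverse rate; summing the left side by parts produces the
    -- drift term.
    have hstep : inverseRate γ ρ (T + 1) * (bootstrapSgdMean γ ρ θ v y (T + 1)
        - bootstrapSgdMean γ ρ θ v y T) = v T * (y T - bootstrapSgdMean γ ρ θ v y T) := by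
      simp only [bootstrapSgdMean, learningRate_eq_inv hγ]
      field_simp
      ring
    linear_combination ih + hstep

/-- The iterates of bootstrap stochastic gradient descent as random variables. -/
noncomputable def randomIterate {Ω : Type*} (γ ρ θ : ℝ) (W e : ℕ → Ω → ℝ) (t : ℕ) (ω : Ω) : ℝ :=
  bootstrapSgdMean γ ρ θ (fun i => W i ω) (fun i => e i ω) t

lemma randomIterate_succ {Ω : Type*} {θ : ℝ} {W e : ℕ → Ω → ℝ} (t : ℕ) (ω : Ω) :
    randomIterate γ ρ θ W e (t + 1) ω =
    randomIterate γ ρ θ W e t ω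
      + learningRate γ ρ (t + 1) * (W t ω * (e t ω - randomIterate γ ρ θ W e t ω)) := by
  simp only [randomIterate, bootstrapSgdMean]; ring

end Recursion

/-! ### Mean squared error of the iterates. -/

section Moments

variable {Ω : Type*} [MeasurableSpace Ω] {μ : Measure Ω}

lemma memLp_two_mul_of_indepFun {X Z : Ω → ℝ} (hX : MemLp X 2 μ) (hZ : MemLp Z 2 μ)
    (h : IndepFun X Z μ) : MemLp (fun ω => X ω * Z ω) 2 μ := by
  refine (memLp_two_iff_integrable_sq (hX.aestronglyMeasurable.mul hZ.aestronglyMeasurable)).2 ?_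
  have h2 : IndepFun (fun ω => X ω ^ 2) (fun ω => Z ω ^ 2) μ :=
    h.comp (φ := fun x => x ^ 2) (ψ := fun x => x ^ 2) (by fun_prop) (by fun_prop)
  exact (h2.integrable_mul hX.integrable_sq hZ.integrable_sq).congr
    (ae_of_all _ fun ω => (mul_pow _ _ _).symm)

lemma sq_integral_abs_le [IsProbabilityMeasure μ] {X : Ω → ℝ} (hX : MemLp X 2 μ) :
    (∫ ω, |X ω| ∂μ) ^ 2 ≤ ∫ ω, X ω ^ 2 ∂μ := by
  have h := variance_nonneg |X| μ
  rw [variance_eq_sub hX.abs] at h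
  simp only [Pi.pow_apply, Pi.abs_apply, sq_abs] at h
  linarith

lemma integral_abs_le_sqrt [IsProbabilityMeasure μ] {X : Ω → ℝ} (hX : MemLp X 2 μ) :
    ∫ ω, |X ω| ∂μ ≤ √(∫ ω, X ω ^ 2 ∂μ) :=
  Real.le_sqrt_of_sq_le (sq_integral_abs_le hX)

variable {γ ρ θ r0 r1 m : ℝ} {W e : ℕ → Ω → ℝ}

lemma measurable_randomIterate (hW : ∀ t, Measurable (W t)) (he : ∀ t, Measurable (e t)) (t : ℕ) :
    Measurable (randomIterate γ ρ θ W e t) :=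
  (measurable_bootstrapSgdMean (γ := γ) (ρ := ρ) θ t).comp
    ((measurable_pi_lambda _ hW).prodMk (measurable_pi_lambda _ he))

lemma IsWeightSequence.indepFun_past (hW : IsWeightSequence W e m μ) {α : Type*}
    [MeasurableSpace α] (t : ℕ) {h : (ℕ → ℝ) × (ℕ → ℝ) → α} (hh : Measurable h) :
    IndepFun (W t) (fun ω => h (truncateSeq t (fun i => W i ω), fun i => e i ω)) μ :=
  (hW.indep_past t).comp (φ := id) (ψ := h) measurable_id hh

lemma bootstrapSgdMean_truncateSeq_left (s t : ℕ) (hst : t ≤ s) (v y : ℕ → ℝ) :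
    bootstrapSgdMean γ ρ θ (truncateSeq s v) y t = bootstrapSgdMean γ ρ θ v y t :=
  bootstrapSgdMean_congr (fun _ hi => truncateSeq_of_lt (hi.trans_le hst) v) fun _ _ => rfl

lemma bootstrapSgdMean_truncateSeq_right (s t : ℕ) (hst : t ≤ s) (v y : ℕ → ℝ) :
    bootstrapSgdMean γ ρ θ v (truncateSeq s y) t = bootstrapSgdMean γ ρ θ v y t :=
  bootstrapSgdMean_congr (fun _ _ => rfl) fun _ hi => truncateSeq_of_lt (hi.trans_le hst) y

lemma IsWeightSequence.indepFun_iterate_noise (hW : IsWeightSequence W e m μ) (t : ℕ) :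
    IndepFun (W t) (fun ω => (randomIterate γ ρ θ W e t ω, e t ω)) μ := by
  have := hW.indepFun_past t (h := fun p => (bootstrapSgdMean γ ρ θ p.1 p.2 t, p.2 t))
    (by fun_prop)
  simp only [bootstrapSgdMean_truncateSeq_left t t le_rfl] at this
  exact this

lemma memLp_randomIterate [IsProbabilityMeasure μ] (hN : IsOneDependentNoise e r0 r1 μ)
    (hW : IsWeightSequence W e m μ) (t : ℕ) : MemLp (randomIterate γ ρ θ W e t) 2 μ := by
  induction t with
  | zero => exact memLp_const θ
  | succ t ih =>
    have h1 : IndepFun (W t) (fun ω => e t ω - randomIterate γ ρ θ W e t ω) μ :=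
      (hW.indepFun_iterate_noise t).comp (φ := id) (ψ := fun p : ℝ × ℝ => p.2 - p.1) measurable_id
        (by fun_prop)
    have h2 := memLp_two_mul_of_indepFun (hW.memLp t) ((hN.memLp t).sub ih) h1
    have h3 := ih.add (h2.const_mul (learningRate γ ρ (t + 1)))
    exact h3.ae_eq (ae_of_all _ fun ω => (randomIterate_succ t ω).symm)

lemma memLp_weight_mul_randomIterate [IsProbabilityMeasure μ] (hN : IsOneDependentNoise e r0 r1 μ)
    (hW : IsWeightSequence W e m μ) (t : ℕ) :
    MemLp (fun ω => W t ω * randomIterate γ ρ θ W e t ω) 2 μ :=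
  memLp_two_mul_of_indepFun (hW.memLp t) (memLp_randomIterate hN hW t)
    ((hW.indepFun_iterate_noise t).comp (φ := id) (ψ := Prod.fst) measurable_id measurable_fst)

lemma memLp_weight_mul_noise [IsProbabilityMeasure μ] (hN : IsOneDependentNoise e r0 r1 μ)
    (hW : IsWeightSequence W e m μ) (t : ℕ) : MemLp (fun ω => W t ω * e t ω) 2 μ :=
  memLp_two_mul_of_indepFun (hW.memLp t) (hN.memLp t)
    (hW.indep_noise.comp (φ := fun v : ℕ → ℝ => v t) (ψ := fun y : ℕ → ℝ => y t)
      (by fun_prop) (by fun_prop))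

lemma IsOneDependentNoise.indepFun_weights_truncateSeq [IsProbabilityMeasure μ]
    (hN : IsOneDependentNoise e r0 r1 μ) (hW : IsWeightSequence W e m μ) (t : ℕ) :
    IndepFun (fun ω => ((fun i => W i ω), truncateSeq t (fun i => e i ω))) (e (t + 1)) μ := by
  have he : Measurable fun ω i => e i ω := measurable_pi_lambda _ hN.measurable
  refine indepFun_prodMk_of_indepFun (measurable_pi_lambda _ hW.measurable)
    ((measurable_truncateSeq t).comp he) (hN.measurable (t + 1)) ?_ ?_
  · exact hW.indep_noise.comp (φ := id) (ψ := fun y : ℕ → ℝ => (truncateSeq t y, y (t + 1)))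
      measurable_id (by fun_prop)
  · exact (hN.indep t).comp (φ := id) (ψ := fun y : ℕ → ℝ => y 0) measurable_id (by fun_prop)

/-- The iterate at time t involves only noise of index below t, which is independent of e (t + 1).
Of the last update, only the term with e t is correlated with e (t + 1), and W t averages to 1
there. -/
lemma integral_randomIterate_succ_mul_noise [IsProbabilityMeasure μ]
    (hN : IsOneDependentNoise e r0 r1 μ) (hW : IsWeightSequence W e m μ) (t : ℕ) :
    ∫ ω, randomIterate γ ρ θ W e (t + 1) ω * e (t + 1) ω ∂μ = learningRate γ ρ (t + 1) * r1 := by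
  set g := learningRate γ ρ (t + 1) with hg
  have hD := memLp_randomIterate (γ := γ) (ρ := ρ) (θ := θ) hN hW t
  have hWD := memLp_weight_mul_randomIterate (γ := γ) (ρ := ρ) (θ := θ) hN hW t
  have hWe := memLp_weight_mul_noise hN hW t
  have he := hN.memLp (t + 1)
  have e1 : ∀ ω, randomIterate γ ρ θ W e (t + 1) ω * e (t + 1) ω =
      (randomIterate γ ρ θ W e t ω - g * (W t ω * randomIterate γ ρ θ W e t ω)) * e (t + 1) ω
        + g * (W t ω * (e t ω * e (t + 1) ω)) := fun ω => by
    rw [randomIterate_succ]; ring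
  simp_rw [e1]
  have i1 : Integrable (fun ω => (randomIterate γ ρ θ W e t ω
      - g * (W t ω * randomIterate γ ρ θ W e t ω)) * e (t + 1) ω) μ :=
    (hD.sub (hWD.const_mul g)).integrable_mul he
  have i2 : Integrable (fun ω => g * (W t ω * (e t ω * e (t + 1) ω))) μ :=
    ((hWe.integrable_mul he).congr (ae_of_all _ fun ω => by simp [mul_assoc])).const_mul g
  rw [integral_add i1 i2, integral_const_mul]
  have h1 : IndepFun (fun ω => randomIterate γ ρ θ W e t ω
      - g * (W t ω * randomIterate γ ρ θ W e t ω)) (e (t + 1)) μ := by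
    have := (hN.indepFun_weights_truncateSeq hW t).comp (ψ := id)
      (φ := fun p => bootstrapSgdMean γ ρ θ p.1 p.2 t
        - g * (p.1 t * bootstrapSgdMean γ ρ θ p.1 p.2 t)) (by fun_prop) measurable_id
    simp only [Function.comp_def, bootstrapSgdMean_truncateSeq_right t t le_rfl] at this
    exact this
  have h2 : IndepFun (W t) (fun ω => e t ω * e (t + 1) ω) μ :=
    hW.indep_noise.comp (φ := fun v : ℕ → ℝ => v t) (ψ := fun y : ℕ → ℝ => y t * y (t + 1))
      (by fun_prop)
      (by fun_prop)
  rw [h1.integral_fun_mul_eq_mul_integral (hD.sub (hWD.const_mul g)).aestronglyMeasurable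
    he.aestronglyMeasurable, h2.integral_fun_mul_eq_mul_integral (hW.memLp t).aestronglyMeasurable
    ((hN.measurable t).mul (hN.measurable (t + 1))).aestronglyMeasurable, hN.mean, hN.cov, hW.mean]
  ring

lemma abs_integral_randomIterate_mul_noise_le [IsProbabilityMeasure μ] (hγ : 0 < γ)
    (hN : IsOneDependentNoise e r0 r1 μ) (hW : IsWeightSequence W e m μ) (t : ℕ) :
    |∫ ω, randomIterate γ ρ θ W e t ω * e t ω ∂μ| ≤ learningRate γ ρ t * |r1| := by
  have hg (t : ℕ) : 0 ≤ learningRate γ ρ t := by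
    rw [learningRate_eq_inv hγ]; exact (inv_pos.2 (inverseRate_pos hγ t)).le
  rcases t with _ | t
  · have : ∀ ω, randomIterate γ ρ θ W e 0 ω = θ := fun _ => rfl
    simp_rw [this]
    rw [integral_const_mul, hN.mean, mul_zero, abs_zero]
    exact mul_nonneg (hg 0) (abs_nonneg _)
  · rw [integral_randomIterate_succ_mul_noise hN hW, abs_mul, abs_of_nonneg (hg _)]

lemma IsWeightSequence.integral_sq_one_sub (hW : IsWeightSequence W e m μ)
    [IsProbabilityMeasure μ] (g : ℝ) (t : ℕ) :
    ∫ ω, (1 - g * W t ω) ^ 2 ∂μ = 1 - 2 * g + g ^ 2 * m := by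
  have h1 := (hW.memLp t).integrable (by norm_num)
  have h2 := (hW.memLp t).integrable_sq
  have : ∀ ω, (1 - g * W t ω) ^ 2 = (1 - 2 * g * W t ω) + g ^ 2 * W t ω ^ 2 := fun ω => by ring
  simp_rw [this]
  have s1 := integral_add (f := fun ω => 1 - 2 * g * W t ω)
    ((integrable_const _).sub (h1.const_mul _)) (h2.const_mul (g ^ 2))
  rw [s1, integral_sub (integrable_const _) (h1.const_mul _), integral_const_mul,
    integral_const_mul, hW.mean, hW.sq]
  simp

lemma IsWeightSequence.integral_one_sub_mul (hW : IsWeightSequence W e m μ)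
    [IsProbabilityMeasure μ] (g : ℝ) (t : ℕ) :
    ∫ ω, (1 - g * W t ω) * W t ω ∂μ = 1 - g * m := by
  have h1 := (hW.memLp t).integrable (by norm_num)
  have h2 := (hW.memLp t).integrable_sq
  have : ∀ ω, (1 - g * W t ω) * W t ω = W t ω - g * W t ω ^ 2 := fun ω => by ring
  simp_rw [this]
  rw [integral_sub h1 (h2.const_mul _), integral_const_mul, hW.mean, hW.sq]

/-- Square D_{t+1} = (1 - gW_t) D_t + gW_t e_t; the weight W_t is independent of the pair (D_t,
e_t), so each expectation factors. -/
lemma integral_sq_randomIterate_succ [IsProbabilityMeasure μ] (hN : IsOneDependentNoise e r0 r1 μ)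
    (hW : IsWeightSequence W e m μ) (t : ℕ) :
    ∫ ω, randomIterate γ ρ θ W e (t + 1) ω ^ 2 ∂μ =
      (1 - 2 * learningRate γ ρ (t + 1) + learningRate γ ρ (t + 1) ^ 2 * m)
        * ∫ ω, randomIterate γ ρ θ W e t ω ^ 2 ∂μ
      + 2 * learningRate γ ρ (t + 1) * ((1 - learningRate γ ρ (t + 1) * m)
        * ∫ ω, randomIterate γ ρ θ W e t ω * e t ω ∂μ)
      + learningRate γ ρ (t + 1) ^ 2 * (m * r0) := by
  set g := learningRate γ ρ (t + 1) with hg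
  have hD := memLp_randomIterate (γ := γ) (ρ := ρ) (θ := θ) hN hW t
  have he := hN.memLp t
  have hWt := hW.memLp t
  have hind := hW.indepFun_iterate_noise (γ := γ) (ρ := ρ) (θ := θ) t
  have h1W : MemLp (fun ω => 1 - g * W t ω) 2 μ := (memLp_const 1).sub (hWt.const_mul g)
  have e1 : ∀ ω, randomIterate γ ρ θ W e (t + 1) ω ^ 2 =
      ((1 - g * W t ω) ^ 2 * randomIterate γ ρ θ W e t ω ^ 2
        + 2 * g * (((1 - g * W t ω) * W t ω) * (randomIterate γ ρ θ W e t ω * e t ω)))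
        + g ^ 2 * (W t ω ^ 2 * e t ω ^ 2) := fun ω => by
    rw [randomIterate_succ]; ring
  simp_rw [e1]
  have ind1 : IndepFun (fun ω => (1 - g * W t ω) ^ 2) (fun ω => randomIterate γ ρ θ W e t ω ^ 2) μ :=
    hind.comp (φ := fun w => (1 - g * w) ^ 2) (ψ := fun p : ℝ × ℝ => p.1 ^ 2)
      (by fun_prop) (by fun_prop)
  have ind2 : IndepFun (fun ω => (1 - g * W t ω) * W t ω)
      (fun ω => randomIterate γ ρ θ W e t ω * e t ω) μ :=
    hind.comp (φ := fun w => (1 - g * w) * w) (ψ := fun p : ℝ × ℝ => p.1 * p.2)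
      (by fun_prop) (by fun_prop)
  have ind3 : IndepFun (fun ω => W t ω ^ 2) (fun ω => e t ω ^ 2) μ :=
    hind.comp (φ := fun w => w ^ 2) (ψ := fun p : ℝ × ℝ => p.2 ^ 2) (by fun_prop) (by fun_prop)
  have i1 := ind1.integrable_mul h1W.integrable_sq hD.integrable_sq
  have i2 := ((ind2.integrable_mul (h1W.integrable_mul hWt) (hD.integrable_mul he))).const_mul
    (2 * g)
  have i3 := (ind3.integrable_mul hWt.integrable_sq he.integrable_sq).const_mul (g ^ 2)
  have s1 := integral_add (i1.add i2) i3
  have s2 := integral_add i1 i2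
  simp only [Pi.mul_apply, Pi.add_apply] at s1 s2
  rw [s1, s2, integral_const_mul, integral_const_mul,
    ind1.integral_fun_mul_eq_mul_integral h1W.integrable_sq.aestronglyMeasurable
      hD.integrable_sq.aestronglyMeasurable,
    ind2.integral_fun_mul_eq_mul_integral (h1W.integrable_mul hWt).aestronglyMeasurable
      (hD.integrable_mul he).aestronglyMeasurable,
    ind3.integral_fun_mul_eq_mul_integral hWt.integrable_sq.aestronglyMeasurable
      he.integrable_sq.aestronglyMeasurable,
    hW.integral_sq_one_sub, hW.integral_one_sub_mul, hN.sq, hW.sq]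

lemma IsOneDependentNoise.r0_nonneg (hN : IsOneDependentNoise e r0 r1 μ) : 0 ≤ r0 := by
  rw [← hN.sq 0]; exact integral_nonneg fun _ => sq_nonneg _

lemma IsWeightSequence.m_nonneg (hW : IsWeightSequence W e m μ) : 0 ≤ m := by
  rw [← hW.sq 0]; exact integral_nonneg fun _ => sq_nonneg _

/-- The mean squared error of the iterates is of the order of the learning rate. -/
lemma exists_integral_sq_randomIterate_le [IsProbabilityMeasure μ] (hγ : 0 < γ) (hρ0 : 0 < ρ)
    (hρ1 : ρ < 1) (hm : m ≤ 2) (hN : IsOneDependentNoise e r0 r1 μ)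
    (hW : IsWeightSequence W e m μ) :
    ∃ C, 0 ≤ C ∧ ∀ t, ∫ ω, randomIterate γ ρ θ W e t ω ^ 2 ∂μ ≤ C * (inverseRate γ ρ t)⁻¹ := by
  have hr0 := hN.r0_nonneg
  have hm0 := hW.m_nonneg
  set G := (inverseRate γ ρ 0)⁻¹ with hG
  have hG0 : 0 ≤ G := (inv_pos.2 (inverseRate_pos hγ 0)).le
  set K := 1 + 1 / γ with hK
  have hK0 : 0 ≤ K := by positivity
  refine exists_le_div_of_recursion (inverseRate_pos hγ) (inverseRate_le_succ hγ hρ0.le)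
    (tendsto_inverseRate_succ_sub hγ hρ0.le hρ1) (tendsto_inverseRate hρ0)
    (fun t => integral_nonneg fun _ => sq_nonneg _)
    -- The first summand bounds the cross term, using |1 - gm| ≤ 1 + 2G and γ_t ≤ K γ_{t+1}; the
    -- second bounds the noise term, as m ≤ 2.
    (C := 2 * (1 + 2 * G) * (K * |r1|) + 2 * r0) (by positivity) fun t => ?_
  rw [integral_sq_randomIterate_succ hN hW, learningRate_eq_inv hγ]
  have hc := abs_integral_randomIterate_mul_noise_le (ρ := ρ) (θ := θ) hγ hN hW t
  rw [learningRate_eq_inv hγ] at hc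
  have hx : 0 ≤ ∫ ω, randomIterate γ ρ θ W e t ω ^ 2 ∂μ := integral_nonneg fun _ => sq_nonneg _
  have ha := inverseRate_pos (ρ := ρ) hγ t
  have hA := inverseRate_pos (ρ := ρ) hγ (t + 1)
  set g := (inverseRate γ ρ (t + 1))⁻¹ with hg
  have hg0 : 0 ≤ g := (inv_pos.2 hA).le
  have hgG : g ≤ G := inv_anti₀ (inverseRate_pos hγ 0) (inverseRate_zero_le hγ hρ0.le _)
  have hgK : (inverseRate γ ρ t)⁻¹ ≤ K * g := by
    rw [hg, ← div_eq_mul_inv, le_div_iff₀ hA, inv_mul_le_iff₀ ha]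
    linarith [inverseRate_succ_le_mul hγ hρ0.le hρ1.le t]
  set x := ∫ ω, randomIterate γ ρ θ W e t ω ^ 2 ∂μ
  set c := ∫ ω, randomIterate γ ρ θ W e t ω * e t ω ∂μ
  have h1 : (1 - 2 * g + g ^ 2 * m) * x ≤ (1 - 2 * g + 2 * g ^ 2) * x := by
    apply mul_le_mul_of_nonneg_right _ hx
    nlinarith [sq_nonneg g]
  have h2 : (1 - g * m) * c ≤ (1 + 2 * G) * (K * |r1| * g) := by
    have h3 : |1 - g * m| ≤ 1 + 2 * G := by
      have : g * m ≤ G * 2 := by gcongr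
      have : 0 ≤ g * m := by positivity
      rw [abs_le]; constructor <;> linarith
    have h4 : |c| ≤ K * |r1| * g := by
      calc |c| ≤ (inverseRate γ ρ t)⁻¹ * |r1| := hc
        _ ≤ K * g * |r1| := by gcongr
        _ = _ := by ring
    calc (1 - g * m) * c ≤ |(1 - g * m) * c| := le_abs_self _
      _ = |1 - g * m| * |c| := abs_mul _ _
      _ ≤ _ := by gcongr
  have h5 : 2 * g * ((1 - g * m) * c) ≤ 2 * g * ((1 + 2 * G) * (K * |r1| * g)) := by gcongr
  have h6 : g ^ 2 * (m * r0) ≤ g ^ 2 * (2 * r0) := by gcongr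
  nlinarith

end Moments

/-! ### Replacing the summed iterates by the weighted noise. -/

section Linearization

variable {Ω : Type*} [MeasurableSpace Ω] {μ : Measure Ω} {γ ρ θ r0 r1 m : ℝ} {W e : ℕ → Ω → ℝ}

lemma IsWeightSequence.integral_sq_sub_one (hW : IsWeightSequence W e m μ)
    [IsProbabilityMeasure μ] (t : ℕ) : ∫ ω, (W t ω - 1) ^ 2 ∂μ = m - 1 := by
  have h := hW.integral_sq_one_sub 1 t
  have : ∀ ω, (1 - 1 * W t ω) ^ 2 = (W t ω - 1) ^ 2 := fun ω => by ring
  simp_rw [this] at h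
  linarith

lemma memLp_martingale_increment [IsProbabilityMeasure μ] (hN : IsOneDependentNoise e r0 r1 μ)
    (hW : IsWeightSequence W e m μ) (t : ℕ) :
    MemLp (fun ω => (W t ω - 1) * randomIterate γ ρ θ W e t ω) 2 μ := by
  simp_rw [sub_one_mul]
  exact (memLp_weight_mul_randomIterate hN hW t).sub (memLp_randomIterate hN hW t)

lemma memLp_martingale [IsProbabilityMeasure μ] (hN : IsOneDependentNoise e r0 r1 μ)
    (hW : IsWeightSequence W e m μ) (T : ℕ) :
    MemLp (fun ω => ∑ t ∈ Finset.range T, (W t ω - 1) * randomIterate γ ρ θ W e t ω) 2 μ :=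
  memLp_finsetSum _ fun t _ => memLp_martingale_increment hN hW t

/-- The increments are orthogonal: W T - 1 is centred and independent of both the partial sum and
the current iterate. -/
lemma integral_sq_martingale [IsProbabilityMeasure μ] (hN : IsOneDependentNoise e r0 r1 μ)
    (hW : IsWeightSequence W e m μ) (T : ℕ) :
    ∫ ω, (∑ t ∈ Finset.range T, (W t ω - 1) * randomIterate γ ρ θ W e t ω) ^ 2 ∂μ =
      ∑ t ∈ Finset.range T, (m - 1) * ∫ ω, randomIterate γ ρ θ W e t ω ^ 2 ∂μ := by
  induction T with
  | zero => simp
  | succ T ih =>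
    rw [Finset.sum_range_succ, ← ih]
    set M : Ω → ℝ := fun ω => ∑ t ∈ Finset.range T, (W t ω - 1) * randomIterate γ ρ θ W e t ω
      with hM
    have hML : MemLp M 2 μ := memLp_martingale hN hW T
    have hD := memLp_randomIterate (γ := γ) (ρ := ρ) (θ := θ) hN hW T
    have hI := memLp_martingale_increment (γ := γ) (ρ := ρ) (θ := θ) hN hW T
    have hWc : MemLp (fun ω => W T ω - 1) 2 μ := (hW.memLp T).sub (memLp_const 1)
    have hind : IndepFun (W T) (fun ω => (M ω, randomIterate γ ρ θ W e T ω)) μ := by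
      have h := hW.indepFun_past (α := ℝ × ℝ) T
        (h := fun p : (ℕ → ℝ) × (ℕ → ℝ) =>
          (∑ t ∈ Finset.range T, (p.1 t - 1) * bootstrapSgdMean γ ρ θ p.1 p.2 t,
          bootstrapSgdMean γ ρ θ p.1 p.2 T)) (by fun_prop)
      convert h using 1
      ext ω
      · simp only [hM]
        refine Finset.sum_congr rfl fun t ht => ?_
        have ht' := Finset.mem_range.1 ht
        rw [bootstrapSgdMean_truncateSeq_left T t ht'.le, truncateSeq_of_lt ht']
        rfl
      · rw [bootstrapSgdMean_truncateSeq_left T T le_rfl]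
        rfl
    have ind1 : IndepFun (fun ω => W T ω - 1) (fun ω => M ω * randomIterate γ ρ θ W e T ω) μ :=
      hind.comp (φ := fun w : ℝ => w - 1) (ψ := fun p : ℝ × ℝ => p.1 * p.2) (by fun_prop)
        (by fun_prop)
    have ind2 : IndepFun (fun ω => (W T ω - 1) ^ 2)
        (fun ω => randomIterate γ ρ θ W e T ω ^ 2) μ :=
      hind.comp (φ := fun w : ℝ => (w - 1) ^ 2) (ψ := fun p : ℝ × ℝ => p.2 ^ 2) (by fun_prop)
        (by fun_prop)
    have e1 : ∀ ω, (∑ t ∈ Finset.range (T + 1), (W t ω - 1) * randomIterate γ ρ θ W e t ω) ^ 2 =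
        (M ω ^ 2 + 2 * ((W T ω - 1) * (M ω * randomIterate γ ρ θ W e T ω)))
          + (W T ω - 1) ^ 2 * randomIterate γ ρ θ W e T ω ^ 2 := fun ω => by
      rw [Finset.sum_range_succ]; simp only [hM]; ring
    simp_rw [e1]
    have i1 : Integrable (fun ω => 2 * ((W T ω - 1) * (M ω * randomIterate γ ρ θ W e T ω))) μ :=
      (ind1.integrable_mul (hWc.integrable (by norm_num)) (hML.integrable_mul hD)).const_mul 2
    have i2 : Integrable (fun ω => (W T ω - 1) ^ 2 * randomIterate γ ρ θ W e T ω ^ 2) μ :=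
      ind2.integrable_mul hWc.integrable_sq hD.integrable_sq
    have s1 := integral_add (f := fun ω => M ω ^ 2
      + 2 * ((W T ω - 1) * (M ω * randomIterate γ ρ θ W e T ω))) (hML.integrable_sq.add i1) i2
    have hmean : ∫ ω, (W T ω - 1) ∂μ = 0 := by
      rw [integral_sub ((hW.memLp T).integrable (by norm_num)) (integrable_const _), hW.mean]
      simp
    rw [s1, integral_add hML.integrable_sq i1, integral_const_mul,
      ind1.integral_fun_mul_eq_mul_integral hWc.aestronglyMeasurable
        (hML.integrable_mul hD).aestronglyMeasurable,
      ind2.integral_fun_mul_eq_mul_integral hWc.integrable_sq.aestronglyMeasurable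
        hD.integrable_sq.aestronglyMeasurable, hmean, hW.integral_sq_sub_one]
    ring

lemma memLp_sum_randomIterate_sub [IsProbabilityMeasure μ] (hN : IsOneDependentNoise e r0 r1 μ)
    (hW : IsWeightSequence W e m μ) (T : ℕ) :
    MemLp (fun ω => ∑ t ∈ Finset.Icc 1 T, randomIterate γ ρ θ W e t ω
      - ∑ t ∈ Finset.range T, W t ω * e t ω) 2 μ :=
  (memLp_finsetSum _ fun t _ => memLp_randomIterate hN hW t).sub
    (memLp_finsetSum _ fun t _ => memLp_weight_mul_noise hN hW t)

/-- The telescoping bound `∑ (a_{t+1} - a_t) / √a_t ≤ (K + 1) √a_T`. -/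
lemma sum_sub_mul_inv_sqrt_le {a : ℕ → ℝ} (ha : ∀ t, 0 < a t) (hmono : ∀ t, a t ≤ a (t + 1))
    {K : ℝ} (hK : 1 ≤ K) (haK : ∀ t, a (t + 1) ≤ K * a t) (T : ℕ) :
    ∑ t ∈ Finset.range T, (a (t + 1) - a t) * (√(a t))⁻¹ ≤ (K + 1) * √(a T) := by
  -- Write the increment as a difference of squares of square roots; the factor √a_{t+1} + √a_t is
  -- at most (K + 1)√a_t.
  have hstep : ∀ t, (a (t + 1) - a t) * (√(a t))⁻¹ ≤ (K + 1) * (√(a (t + 1)) - √(a t)) := by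
    intro t
    have h1 := Real.sqrt_pos.2 (ha t)
    have h2 := Real.sqrt_le_sqrt (hmono t)
    have h3 : √(a (t + 1)) ≤ K * √(a t) := by
      calc √(a (t + 1)) ≤ √(K ^ 2 * a t) := by
            apply Real.sqrt_le_sqrt
            have h5 : K * a t ≤ K ^ 2 * a t :=
              mul_le_mul_of_nonneg_right (by nlinarith) (ha t).le
            exact (haK t).trans h5
        _ = K * √(a t) := by
            rw [Real.sqrt_mul (by positivity), Real.sqrt_sq (by linarith)]
    have h4 : a (t + 1) - a t = (√(a (t + 1)) - √(a t)) * (√(a (t + 1)) + √(a t)) := by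
      have := Real.mul_self_sqrt (ha t).le
      have := Real.mul_self_sqrt (ha (t + 1)).le
      linarith
    rw [h4, ← div_eq_mul_inv, div_le_iff₀ h1]
    nlinarith
  calc _ ≤ ∑ t ∈ Finset.range T, (K + 1) * (√(a (t + 1)) - √(a t)) :=
        Finset.sum_le_sum fun t _ => hstep t
    _ = (K + 1) * (√(a T) - √(a 0)) := by
        rw [← Finset.mul_sum, Finset.sum_range_sub (fun t => √(a t))]
    _ ≤ _ := by
        have := Real.sqrt_nonneg (a 0)
        gcongr
        linarith

/-- Each remainder in `sum_bootstrapSgdMean_sub` is bounded in L¹. Since E|D_t| = O(a_t^{-1/2}), the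
last iterate contributes O(√a_T), and so does the drift, by telescoping; the initial value gives a
constant, and the martingale is controlled by its L² norm. -/
lemma integral_abs_sum_randomIterate_sub_le [IsProbabilityMeasure μ] (hγ : 0 < γ) (hρ0 : 0 < ρ)
    (hρ1 : ρ < 1) (hm : m ≤ 2) (hN : IsOneDependentNoise e r0 r1 μ)
    (hW : IsWeightSequence W e m μ) :
    ∃ L, ∀ T : ℕ, ∫ ω, |∑ t ∈ Finset.Icc 1 T, randomIterate γ ρ θ W e t ω
        - ∑ t ∈ Finset.range T, W t ω * e t ω| ∂μ ≤
      L * √(inverseRate γ ρ T) + L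
        + √(L * ∑ t ∈ Finset.range T, (inverseRate γ ρ t)⁻¹) := by
  obtain ⟨C, hC, hCb⟩ := exists_integral_sq_randomIterate_le (θ := θ) hγ hρ0 hρ1 hm hN hW
  set a := inverseRate γ ρ with ha_def
  have ha := inverseRate_pos (ρ := ρ) hγ
  rw [← ha_def] at ha
  set K := 1 + 1 / γ with hK
  have hK1 : 1 ≤ K := by have := one_div_pos.2 hγ; linarith
  have hD (t : ℕ) := memLp_randomIterate (γ := γ) (ρ := ρ) (θ := θ) hN hW t
  have hDi (t : ℕ) := (hD t).integrable (q := 2) (by norm_num)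
  have hDabs (t : ℕ) : ∫ ω, |randomIterate γ ρ θ W e t ω| ∂μ ≤ √C * (√(a t))⁻¹ := by
    refine (integral_abs_le_sqrt (hD t)).trans ?_
    rw [← Real.sqrt_inv, ← Real.sqrt_mul hC]
    exact Real.sqrt_le_sqrt (hCb t)
  have hm1 : 0 ≤ m - 1 := by
    rw [← hW.integral_sq_sub_one 0]; exact integral_nonneg fun _ => sq_nonneg _
  have hMabs (T : ℕ) : ∫ ω, |∑ t ∈ Finset.range T, (W t ω - 1) * randomIterate γ ρ θ W e t ω| ∂μ
      ≤ √(C * ∑ t ∈ Finset.range T, (a t)⁻¹) := by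
    refine (integral_abs_le_sqrt (memLp_martingale hN hW T)).trans (Real.sqrt_le_sqrt ?_)
    rw [integral_sq_martingale hN hW, Finset.mul_sum]
    refine Finset.sum_le_sum fun t _ => ?_
    have h0 : 0 ≤ ∫ ω, randomIterate γ ρ θ W e t ω ^ 2 ∂μ := integral_nonneg fun _ => sq_nonneg _
    calc _ ≤ 1 * ∫ ω, randomIterate γ ρ θ W e t ω ^ 2 ∂μ := by gcongr; linarith
      _ ≤ _ := by rw [one_mul]; exact hCb t
  have hb0 (t : ℕ) : 0 ≤ a (t + 1) - a t := sub_nonneg.2 (inverseRate_le_succ hγ hρ0.le t)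
  have hBabs (T : ℕ) : ∫ ω, |∑ t ∈ Finset.range T,
      (a (t + 1) - a t) * randomIterate γ ρ θ W e t ω| ∂μ ≤ √C * ((K + 1) * √(a T)) := by
    calc _ ≤ ∫ ω, ∑ t ∈ Finset.range T,
          (a (t + 1) - a t) * |randomIterate γ ρ θ W e t ω| ∂μ := by
          refine integral_mono (integrable_finsetSum _ fun t _ => (hDi t).const_mul _).abs
            (integrable_finsetSum _ fun t _ => (hDi t).abs.const_mul _) fun ω => ?_
          refine (Finset.abs_sum_le_sum_abs _ _).trans (Finset.sum_le_sum fun t _ => ?_)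
          rw [abs_mul, abs_of_nonneg (hb0 t)]
      _ = ∑ t ∈ Finset.range T,
          (a (t + 1) - a t) * ∫ ω, |randomIterate γ ρ θ W e t ω| ∂μ := by
          rw [integral_finsetSum _ fun t _ => (hDi t).abs.const_mul _]
          exact Finset.sum_congr rfl fun t _ => integral_const_mul _ _
      _ ≤ ∑ t ∈ Finset.range T, √C * ((a (t + 1) - a t) * (√(a t))⁻¹) := by
          refine Finset.sum_le_sum fun t _ => ?_
          calc _ ≤ (a (t + 1) - a t) * (√C * (√(a t))⁻¹) :=
                mul_le_mul_of_nonneg_left (hDabs t) (hb0 t)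
            _ = _ := by ring
      _ ≤ _ := by
          rw [← Finset.mul_sum]
          gcongr
          exact sum_sub_mul_inv_sqrt_le ha (inverseRate_le_succ hγ hρ0.le) hK1
            (inverseRate_succ_le_mul hγ hρ0.le hρ1.le) T
  have hlast (T : ℕ) : ∫ ω, |(1 - a T) * randomIterate γ ρ θ W e T ω| ∂μ
      ≤ ((a 0)⁻¹ + 1) * √C * √(a T) := by
    simp_rw [abs_mul]
    rw [integral_const_mul]
    -- The additive 1 is absorbed by a_T/a_0 ≥ 1.
    have h1 : |1 - a T| ≤ ((a 0)⁻¹ + 1) * a T := by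
      have h2 : 1 ≤ (a 0)⁻¹ * a T := by
        rw [inv_mul_eq_div, one_le_div (ha 0)]; exact inverseRate_zero_le hγ hρ0.le T
      have := ha T
      rw [abs_le]; constructor <;> nlinarith
    calc _ ≤ ((a 0)⁻¹ + 1) * a T * (√C * (√(a T))⁻¹) :=
          mul_le_mul h1 (hDabs T) (integral_nonneg fun _ => abs_nonneg _)
            (by have := ha T; have := ha 0; positivity)
      _ = ((a 0)⁻¹ + 1) * √C * (a T * (√(a T))⁻¹) := by ring
      _ = _ := by rw [← div_eq_mul_inv, Real.div_sqrt]
  set L1 := ((a 0)⁻¹ + 1) * √C + √C * (K + 1) with hL1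
  have hL10 : 0 ≤ L1 := by have := ha 0; positivity
  refine ⟨L1 + |(1 - a 0) * θ| + C, fun T => ?_⟩
  have hM := (memLp_martingale (γ := γ) (ρ := ρ) (θ := θ) hN hW T).integrable (by norm_num)
  have hB : Integrable (fun ω => ∑ t ∈ Finset.range T,
      (a (t + 1) - a t) * randomIterate γ ρ θ W e t ω) μ :=
    integrable_finsetSum _ fun t _ => (hDi t).const_mul _
  have hpt (ω : Ω) : |∑ t ∈ Finset.Icc 1 T, randomIterate γ ρ θ W e t ω
        - ∑ t ∈ Finset.range T, W t ω * e t ω| ≤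
      ((|(1 - a T) * randomIterate γ ρ θ W e T ω| + |(1 - a 0) * θ|)
      + |∑ t ∈ Finset.range T, (W t ω - 1) * randomIterate γ ρ θ W e t ω|)
      + |∑ t ∈ Finset.range T, (a (t + 1) - a t) * randomIterate γ ρ θ W e t ω| := by
    have h := sum_bootstrapSgdMean_sub (ρ := ρ) hγ θ (fun i => W i ω) (fun i => e i ω) T
    simp only [randomIterate]
    rw [h]
    refine (abs_add_le _ _).trans (add_le_add ?_ le_rfl)
    exact (abs_sub _ _).trans (add_le_add (abs_sub _ _) le_rfl)
  have hTi : Integrable (fun ω => |(1 - a T) * randomIterate γ ρ θ W e T ω|) μ :=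
    ((hDi T).const_mul _).abs
  have s1 := integral_add ((hTi.add (integrable_const |(1 - a 0) * θ|)).add hM.abs) hB.abs
  have s2 := integral_add (hTi.add (integrable_const |(1 - a 0) * θ|)) hM.abs
  have s3 := integral_add hTi (integrable_const |(1 - a 0) * θ|)
  simp only [Pi.add_apply, integral_const, probReal_univ, one_smul] at s1 s2 s3
  have hmain := integral_mono
    ((memLp_sum_randomIterate_sub (γ := γ) (ρ := ρ) (θ := θ) hN hW T).integrable (by norm_num)).abs
    (((hTi.add (integrable_const |(1 - a 0) * θ|)).add hM.abs).add hB.abs) hpt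
  simp only [Pi.add_apply] at hmain
  rw [s1, s2, s3] at hmain
  have hsum : 0 ≤ ∑ t ∈ Finset.range T, (a t)⁻¹ :=
    Finset.sum_nonneg fun t _ => (inv_pos.2 (ha t)).le
  have hθ := abs_nonneg ((1 - a 0) * θ)
  have hfin : √(C * ∑ t ∈ Finset.range T, (a t)⁻¹)
      ≤ √((L1 + |(1 - a 0) * θ| + C) * ∑ t ∈ Finset.range T, (a t)⁻¹) := by
    apply Real.sqrt_le_sqrt
    gcongr
    linarith
  have hs := Real.sqrt_nonneg (a T)
  have h1 := hlast T
  have h2 := hMabs T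
  have h3 := hBabs T
  have h4 : 0 ≤ (|(1 - a 0) * θ| + C) * √(a T) := by positivity
  nlinarith

/-- The averaged iterates are asymptotically the average of the weighted noise. -/
lemma tendsto_integral_abs_sum_randomIterate_sub [IsProbabilityMeasure μ] (hγ : 0 < γ)
    (hρ0 : 0 < ρ) (hρ1 : ρ < 1) (hm : m ≤ 2) (hN : IsOneDependentNoise e r0 r1 μ)
    (hW : IsWeightSequence W e m μ) :
    Tendsto (fun T : ℕ => (√T)⁻¹ * ∫ ω, |∑ t ∈ Finset.Icc 1 T, randomIterate γ ρ θ W e t ω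
        - ∑ t ∈ Finset.range T, W t ω * e t ω| ∂μ) atTop (𝓝 0) := by
  obtain ⟨L, hL⟩ := integral_abs_sum_randomIterate_sub_le (θ := θ) hγ hρ0 hρ1 hm hN hW
  have hinv : Tendsto (fun T : ℕ => (√(T : ℝ))⁻¹) atTop (𝓝 0) :=
    tendsto_inv_atTop_zero.comp (Real.tendsto_sqrt_atTop.comp tendsto_natCast_atTop_atTop)
  have h1 : Tendsto (fun T : ℕ => √(inverseRate γ ρ T / T)) atTop (𝓝 0) := by
    simpa using (tendsto_inverseRate_div hγ hρ0.le hρ1).sqrt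
  -- The martingale part, divided by √T, is the root of a Cesàro mean of learning rates, which tend
  -- to zero.
  have h2 : Tendsto (fun T : ℕ => √(L * ((T : ℝ)⁻¹ * ∑ t ∈ Finset.range T,
      (inverseRate γ ρ t)⁻¹))) atTop (𝓝 0) := by
    have := ((tendsto_inv_atTop_zero.comp (tendsto_inverseRate (γ := γ) hρ0)).cesaro.const_mul L).sqrt
    simpa using this
  have hsum := ((h1.const_mul L).add (hinv.const_mul L)).add h2
  simp only [mul_zero, add_zero] at hsum
  refine squeeze_zero (fun T => mul_nonneg (by positivity) (integral_nonneg fun _ => abs_nonneg _))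
    (fun T => ?_) hsum
  calc _ ≤ (√(T : ℝ))⁻¹ * (L * √(inverseRate γ ρ T) + L
        + √(L * ∑ t ∈ Finset.range T, (inverseRate γ ρ t)⁻¹)) := by gcongr; exact hL T
    _ = _ := by
      have e1 : √(inverseRate γ ρ T / T) = √(inverseRate γ ρ T) * (√(T : ℝ))⁻¹ := by
        rw [Real.sqrt_div' _ (Nat.cast_nonneg T), div_eq_mul_inv]
      have e2 : √(L * ((T : ℝ)⁻¹ * ∑ t ∈ Finset.range T, (inverseRate γ ρ t)⁻¹)) =
          √(L * ∑ t ∈ Finset.range T, (inverseRate γ ρ t)⁻¹) * (√(T : ℝ))⁻¹ := by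
        rw [mul_left_comm, ← div_eq_inv_mul, Real.sqrt_div' _ (Nat.cast_nonneg T), div_eq_mul_inv]
      rw [e1, e2]
      ring

end Linearization

/-! ### Central limit theorem for 1-dependent sequences, by blocks. -/

section OneDependentCLT

variable {Ω : Type*} [MeasurableSpace Ω] {μ : Measure Ω} {r0 r1 : ℝ} {e : ℕ → Ω → ℝ}

lemma IsOneDependentNoise.indepFun_of_add_two_le (hN : IsOneDependentNoise e r0 r1 μ) {s t : ℕ}
    (h : s + 2 ≤ t) : IndepFun (e s) (e t) μ := by
  have e1 : ((fun y : ℕ → ℝ => y s) ∘ fun ω => truncateSeq (s + 1) fun i => e i ω) = e s := by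
    ext ω; exact truncateSeq_of_lt s.lt_succ_self fun i => e i ω
  have e2 : ((fun y : ℕ → ℝ => y (t - (s + 2))) ∘ fun ω i => e (s + 1 + 1 + i) ω) = e t := by
    ext ω; simp only [Function.comp, show s + 1 + 1 + (t - (s + 2)) = t by omega]
  rw [← e1, ← e2]
  exact (hN.indep (s + 1)).comp (by fun_prop) (by fun_prop)

lemma IsOneDependentNoise.integral_mul_eq_zero (hN : IsOneDependentNoise e r0 r1 μ) {s t : ℕ}
    (h : s + 2 ≤ t) : ∫ ω, e s ω * e t ω ∂μ = 0 := by
  rw [(hN.indepFun_of_add_two_le h).integral_fun_mul_eq_mul_integral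
    (hN.memLp s).aestronglyMeasurable (hN.memLp t).aestronglyMeasurable, hN.mean, zero_mul]

lemma integral_add_sq {X Z : Ω → ℝ} (hX : MemLp X 2 μ) (hZ : MemLp Z 2 μ) :
    ∫ ω, (X ω + Z ω) ^ 2 ∂μ = ∫ ω, X ω ^ 2 ∂μ + 2 * ∫ ω, X ω * Z ω ∂μ + ∫ ω, Z ω ^ 2 ∂μ := by
  have e1 : ∀ ω, (X ω + Z ω) ^ 2 = (X ω ^ 2 + 2 * (X ω * Z ω)) + Z ω ^ 2 := fun ω => by ring
  simp_rw [e1]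
  have i : Integrable (fun ω => 2 * (X ω * Z ω)) μ := (hX.integrable_mul hZ).const_mul 2
  have s1 := integral_add (f := fun ω => X ω ^ 2 + 2 * (X ω * Z ω)) (hX.integrable_sq.add i)
    hZ.integrable_sq
  rw [s1, integral_add hX.integrable_sq i, integral_const_mul]

lemma IsOneDependentNoise.integral_sum_mul (hN : IsOneDependentNoise e r0 r1 μ) (f : ℕ → ℕ)
    (n t : ℕ) : ∫ ω, (∑ j ∈ Finset.range n, e (f j) ω) * e t ω ∂μ =
      ∑ j ∈ Finset.range n, ∫ ω, e (f j) ω * e t ω ∂μ := by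
  simp_rw [Finset.sum_mul]
  exact integral_finsetSum _ fun j _ => (hN.memLp (f j)).integrable_mul (hN.memLp t)

lemma IsOneDependentNoise.memLp_sum (hN : IsOneDependentNoise e r0 r1 μ) (f : ℕ → ℕ) (n : ℕ) :
    MemLp (fun ω => ∑ j ∈ Finset.range n, e (f j) ω) 2 μ :=
  memLp_finsetSum _ fun j _ => hN.memLp (f j)

/-- Terms at distance at least two are uncorrelated. It is applied to the gaps between blocks. -/
lemma IsOneDependentNoise.integral_sq_sum_of_separated (hN : IsOneDependentNoise e r0 r1 μ)
    {f : ℕ → ℕ} (hf : ∀ i j, i < j → f i + 2 ≤ f j) (n : ℕ) :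
    ∫ ω, (∑ j ∈ Finset.range n, e (f j) ω) ^ 2 ∂μ = n * r0 := by
  induction n with
  | zero => simp
  | succ n ih =>
    simp_rw [Finset.sum_range_succ]
    rw [integral_add_sq (hN.memLp_sum f n) (hN.memLp (f n)), ih, hN.sq, hN.integral_sum_mul,
      Finset.sum_eq_zero fun j hj => hN.integral_mul_eq_zero (hf j n (Finset.mem_range.1 hj))]
    push_cast; ring

lemma IsOneDependentNoise.integral_sq_sum_range (hN : IsOneDependentNoise e r0 r1 μ) (k : ℕ) :
    ∫ ω, (∑ i ∈ Finset.range (k + 1), e i ω) ^ 2 ∂μ = (k + 1) * r0 + 2 * k * r1 := by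
  induction k with
  | zero => simp [hN.sq]
  | succ k ih =>
    simp_rw [Finset.sum_range_succ _ (k + 1)]
    have hS := hN.memLp_sum id (k + 1)
    simp only [id] at hS
    rw [integral_add_sq hS (hN.memLp (k + 1)), hN.sq, ih]
    have := hN.integral_sum_mul id (k + 1) (k + 1)
    simp only [id] at this
    rw [this, Finset.sum_range_succ, hN.cov, Finset.sum_eq_zero fun j hj =>
      hN.integral_mul_eq_zero (by have := Finset.mem_range.1 hj; omega)]
    push_cast; ring

lemma tendsto_block_variance (r0 r1 : ℝ) :
    Tendsto (fun k : ℕ => (((k : ℝ) + 1) * r0 + 2 * k * r1) / (k + 2)) atTop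
      (𝓝 (r0 + 2 * r1)) := by
  have h : Tendsto (fun k : ℕ => ((k : ℝ) + 2)⁻¹) atTop (𝓝 0) :=
    tendsto_inv_atTop_zero.comp (tendsto_natCast_add_const 2)
  have := (h.mul_const (-(r0 + 4 * r1))).add_const (r0 + 2 * r1)
  rw [zero_mul, zero_add] at this
  refine this.congr fun k => ?_
  have : (k : ℝ) + 2 ≠ 0 := by positivity
  field_simp
  ring

/-- It is a limit of normalised variances of partial sums. -/
lemma IsOneDependentNoise.long_run_variance_nonneg (hN : IsOneDependentNoise e r0 r1 μ) :
    0 ≤ r0 + 2 * r1 := by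
  refine ge_of_tendsto' (tendsto_block_variance r0 r1) fun k => ?_
  rw [← hN.integral_sq_sum_range k]
  exact div_nonneg (integral_nonneg fun _ => sq_nonneg _) (by positivity)

lemma IsOneDependentNoise.identDistrib_block (hN : IsOneDependentNoise e r0 r1 μ) (k s : ℕ) :
    IdentDistrib (fun ω => ∑ i ∈ Finset.range k, e (s + i) ω)
      (fun ω => ∑ i ∈ Finset.range k, e i ω) μ μ := by
  have h := (hN.stationary s).comp (u := fun y : ℕ → ℝ => ∑ i ∈ Finset.range k, y i)
    (by fun_prop)
  simpa only [Function.comp_def, add_comm _ s] using h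

/-- Blocks have length k and period k + 1, so one skipped index separates neighbours, exactly what
1-dependence requires. -/
lemma IsOneDependentNoise.indepFun_sum_block [IsProbabilityMeasure μ]
    (hN : IsOneDependentNoise e r0 r1 μ) (k n : ℕ) :
    IndepFun (fun ω => ∑ j ∈ Finset.range n, ∑ i ∈ Finset.range k, e (j * (k + 1) + i) ω)
      (fun ω => ∑ i ∈ Finset.range k, e (n * (k + 1) + i) ω) μ := by
  rcases n with _ | n
  · simp only [Finset.range_zero, Finset.sum_empty]
    exact indepFun_const_left _ _
  -- The index n(k + 1) + k is the gap: the earlier blocks lie strictly before it and the next block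
  -- starts right after it.
  · have h := (hN.indep (n * (k + 1) + k)).comp
      (φ := fun y : ℕ → ℝ => ∑ j ∈ Finset.range (n + 1), ∑ i ∈ Finset.range k, y (j * (k + 1) + i))
      (ψ := fun y : ℕ → ℝ => ∑ i ∈ Finset.range k, y i) (by fun_prop) (by fun_prop)
    convert h using 1
    · ext ω
      refine Finset.sum_congr rfl fun j hj => Finset.sum_congr rfl fun i hi => ?_
      refine (truncateSeq_of_lt ?_ fun i => e i ω).symm
      have h1 := Finset.mem_range.1 hi
      have h2 : j * (k + 1) ≤ n * (k + 1) :=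
        Nat.mul_le_mul_right _ (Nat.lt_succ_iff.1 (Finset.mem_range.1 hj))
      omega
    · ext ω
      refine Finset.sum_congr rfl fun i _ => ?_
      simp only [show (n + 1) * (k + 1) + i = n * (k + 1) + k + 1 + i by ring]

lemma IsOneDependentNoise.charFun_sum_blocks [IsProbabilityMeasure μ]
    (hN : IsOneDependentNoise e r0 r1 μ) (k n : ℕ) (t : ℝ) :
    charFun (μ.map fun ω => ∑ j ∈ Finset.range n, ∑ i ∈ Finset.range k, e (j * (k + 1) + i) ω) t =
      charFun (μ.map fun ω => ∑ i ∈ Finset.range k, e i ω) t ^ n := by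
  have hm := hN.measurable
  induction n with
  | zero => simp
  | succ n ih =>
    simp_rw [Finset.sum_range_succ _ n]
    rw [(hN.indepFun_sum_block k n).charFun_map_fun_add_eq_mul (by fun_prop) (by fun_prop),
      Pi.mul_apply, ih, (hN.identDistrib_block k (n * (k + 1))).map_eq, pow_succ]

/-- The map x ↦ exp(itx) is |t|-Lipschitz, so L¹-small errors may be dropped. -/
lemma norm_charFun_map_sub_le [IsProbabilityMeasure μ] {X Z : Ω → ℝ} (hX : AEMeasurable X μ)
    (hZ : AEMeasurable Z μ) (hXZ : Integrable (fun ω => X ω - Z ω) μ) (t : ℝ) :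
    ‖charFun (μ.map X) t - charFun (μ.map Z) t‖ ≤ |t| * ∫ ω, |X ω - Z ω| ∂μ := by
  have hint (A : Ω → ℝ) (hA : AEMeasurable A μ) :
      Integrable (fun ω => Complex.exp (t * A ω * Complex.I)) μ := by
    refine Integrable.of_bound (by fun_prop) 1 (ae_of_all _ fun ω => ?_)
    rw [← Complex.ofReal_mul, Complex.norm_exp_ofReal_mul_I]
  rw [charFun_apply_real, charFun_apply_real, integral_map hX (by fun_prop),
    integral_map hZ (by fun_prop), ← integral_sub (hint X hX) (hint Z hZ), ← integral_const_mul]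
  refine norm_integral_le_of_norm_le (hXZ.abs.const_mul _) (ae_of_all _ fun ω => ?_)
  have h1 : Complex.exp (t * X ω * Complex.I) - Complex.exp (t * Z ω * Complex.I) =
      Complex.exp ((t * Z ω : ℝ) * Complex.I)
        * (Complex.exp (Complex.I * (t * (X ω - Z ω) : ℝ)) - 1) := by
    rw [mul_sub, ← Complex.exp_add, mul_one]
    push_cast
    ring_nf
  rw [h1, norm_mul, Complex.norm_exp_ofReal_mul_I, one_mul, ← abs_mul]
  exact Real.norm_exp_I_mul_ofReal_sub_one_le

lemma sum_range_mul_eq_blocks (y : ℕ → ℝ) (k n : ℕ) :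
    ∑ t ∈ Finset.range (n * (k + 1)), y t =
      ∑ j ∈ Finset.range n, ∑ i ∈ Finset.range k, y (j * (k + 1) + i)
        + ∑ j ∈ Finset.range n, y (j * (k + 1) + k) := by
  induction n with
  | zero => simp
  | succ n ih =>
    rw [Nat.succ_mul, Finset.sum_range_add, ih, Finset.sum_range_succ _ n,
      Finset.sum_range_succ _ n, Finset.sum_range_succ _ k]
    ring

lemma IsOneDependentNoise.integral_abs_le [IsProbabilityMeasure μ]
    (hN : IsOneDependentNoise e r0 r1 μ) (t : ℕ) : ∫ ω, |e t ω| ∂μ ≤ √r0 := by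
  rw [← hN.sq t]; exact integral_abs_le_sqrt (hN.memLp t)

/-- Dropping the gaps between the blocks and the last, incomplete block changes the sum by little. -/
lemma IsOneDependentNoise.integral_abs_sum_sub_blocks_le [IsProbabilityMeasure μ]
    (hN : IsOneDependentNoise e r0 r1 μ) {k : ℕ} (hk : 0 < k) (T : ℕ) :
    ∫ ω, |∑ t ∈ Finset.range T, e t ω - ∑ j ∈ Finset.range (T / (k + 1)),
        ∑ i ∈ Finset.range k, e (j * (k + 1) + i) ω| ∂μ ≤
      √((T / (k + 1) : ℕ) * r0) + (k + 1) * √r0 := by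
  set n := T / (k + 1) with hn
  have hT : n * (k + 1) + T % (k + 1) = T := by rw [hn, mul_comm]; exact Nat.div_add_mod T (k + 1)
  have hpt : ∀ ω, ∑ t ∈ Finset.range T, e t ω - ∑ j ∈ Finset.range n,
        ∑ i ∈ Finset.range k, e (j * (k + 1) + i) ω =
      ∑ j ∈ Finset.range n, e (j * (k + 1) + k) ω
        + ∑ i ∈ Finset.range (T % (k + 1)), e (n * (k + 1) + i) ω := fun ω => by
    have h1 := sum_range_mul_eq_blocks (fun t => e t ω) k n
    have h2 := Finset.sum_range_add (fun t => e t ω) (n * (k + 1)) (T % (k + 1))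
    rw [hT] at h2
    rw [h2, h1]; ring
  simp_rw [hpt]
  have hG := hN.memLp_sum (fun j => j * (k + 1) + k) n
  have hR := hN.memLp_sum (fun i => n * (k + 1) + i) (T % (k + 1))
  have hGi := (hG.integrable (by norm_num)).abs
  have hRi := (hR.integrable (by norm_num)).abs
  calc _ ≤ ∫ ω, (|∑ j ∈ Finset.range n, e (j * (k + 1) + k) ω|
        + |∑ i ∈ Finset.range (T % (k + 1)), e (n * (k + 1) + i) ω|) ∂μ :=
        integral_mono ((hG.add hR).integrable (by norm_num)).abs (hGi.add hRi)
          fun ω => abs_add_le _ _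
    _ = ∫ ω, |∑ j ∈ Finset.range n, e (j * (k + 1) + k) ω| ∂μ
        + ∫ ω, |∑ i ∈ Finset.range (T % (k + 1)), e (n * (k + 1) + i) ω| ∂μ :=
        integral_add hGi hRi
    _ ≤ √(n * r0) + (k + 1) * √r0 := by
      refine add_le_add ?_ ?_
      · refine (integral_abs_le_sqrt hG).trans ?_
        -- Gap indices are k + 1 apart, which is at least 2 because k > 0.
        rw [hN.integral_sq_sum_of_separated fun i j hij => ?_]
        have : (i + 1) * (k + 1) ≤ j * (k + 1) := Nat.mul_le_mul_right _ hij
        have h3 : (i + 1) * (k + 1) = i * (k + 1) + (k + 1) := by ring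
        omega
      · calc _ ≤ ∫ ω, ∑ i ∈ Finset.range (T % (k + 1)), |e (n * (k + 1) + i) ω| ∂μ :=
              integral_mono hRi (integrable_finsetSum _ fun i _ =>
                ((hN.memLp _).integrable (by norm_num)).abs) fun ω =>
                Finset.abs_sum_le_sum_abs _ _
          _ = ∑ i ∈ Finset.range (T % (k + 1)), ∫ ω, |e (n * (k + 1) + i) ω| ∂μ :=
              integral_finsetSum _ fun i _ => ((hN.memLp _).integrable (by norm_num)).abs
          _ ≤ ∑ i ∈ Finset.range (T % (k + 1)), √r0 :=
              Finset.sum_le_sum fun i _ => hN.integral_abs_le _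
          _ ≤ (k + 1) * √r0 := by
              rw [Finset.sum_const, Finset.card_range, nsmul_eq_mul]
              have h4 : T % (k + 1) ≤ k + 1 := (Nat.mod_lt _ (by omega)).le
              have h5 : ((T % (k + 1) : ℕ) : ℝ) ≤ k + 1 := by exact_mod_cast h4
              have := Real.sqrt_nonneg r0
              gcongr

lemma tendsto_natDiv_div (p : ℕ) (hp : 0 < p) :
    Tendsto (fun T : ℕ => ((T / p : ℕ) : ℝ) / T) atTop (𝓝 (1 / p)) := by
  have h := (tendsto_nat_floor_mul_div_atTop (R := ℝ) (a := 1 / p) (by positivity)).comp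
    tendsto_natCast_atTop_atTop
  refine h.congr fun T => ?_
  simp only [Function.comp]
  rw [one_div_mul_eq_div, Nat.floor_div_natCast, Nat.floor_natCast]

/-- For a fixed block length k + 1 the blocks are i.i.d., and about T/(k + 2) of them fit, so this
is the i.i.d. theorem with equal weights T^{-1/2}. -/
lemma IsOneDependentNoise.tendsto_charFun_blocks [IsProbabilityMeasure μ]
    (hN : IsOneDependentNoise e r0 r1 μ) (k : ℕ) (t : ℝ) :
    Tendsto (fun T : ℕ => charFun (μ.map fun ω => (√(T : ℝ))⁻¹ *
        ∑ j ∈ Finset.range (T / (k + 1 + 1)), ∑ i ∈ Finset.range (k + 1),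
          e (j * (k + 1 + 1) + i) ω) t) atTop
      (𝓝 (Complex.exp (-((((k : ℝ) + 1) * r0 + 2 * k * r1) / (k + 2) * t ^ 2 / 2 : ℝ)))) := by
  have hB := hN.memLp_sum id (k + 1)
  simp only [id] at hB
  have hBsq := hN.integral_sq_sum_range k
  have hB0 : ∫ ω, ∑ i ∈ Finset.range (k + 1), e i ω ∂μ = 0 := by
    rw [integral_finsetSum _ fun i _ => (hN.memLp i).integrable (by norm_num)]
    exact Finset.sum_eq_zero fun i _ => hN.mean i
  have hv : 0 ≤ ((k : ℝ) + 1) * r0 + 2 * k * r1 := by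
    rw [← hBsq]; exact integral_nonneg fun _ => sq_nonneg _
  have hm := hN.measurable
  have : IsProbabilityMeasure (μ.map fun ω => ∑ i ∈ Finset.range (k + 1), e i ω) :=
    Measure.isProbabilityMeasure_map hB.aemeasurable
  have hinv : Tendsto (fun T : ℕ => (√(T : ℝ))⁻¹) atTop (𝓝 0) :=
    tendsto_inv_atTop_zero.comp (Real.tendsto_sqrt_atTop.comp tendsto_natCast_atTop_atTop)
  have key := tendsto_prod_of_taylor_two hv (taylor_charFun_two_of_integral_sq hB hB0 hBsq)
    (fun t => norm_charFun_le_one t) (l := atTop) (n := fun T : ℕ => T / (k + 1 + 1))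
    (u := fun T _ => (√(T : ℝ))⁻¹ * t) (r := t ^ 2 / (k + 2)) (by
      have h := (tendsto_natDiv_div (k + 1 + 1) (by omega)).mul_const (t ^ 2)
      convert h using 2 with T
      · rw [Finset.sum_const, Finset.card_range, nsmul_eq_mul, mul_pow, inv_pow,
          Real.sq_sqrt (Nat.cast_nonneg T)]
        ring
      · push_cast; ring) (fun δ hδ => by
      have h := (hinv.mul_const t).abs
      simp only [zero_mul, abs_zero] at h
      filter_upwards [h.eventually_lt_const hδ] with T hT i _ using hT)
  have e1 : ∀ T : ℕ, charFun (μ.map fun ω => (√(T : ℝ))⁻¹ *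
        ∑ j ∈ Finset.range (T / (k + 1 + 1)), ∑ i ∈ Finset.range (k + 1),
          e (j * (k + 1 + 1) + i) ω) t = ∏ i ∈ Finset.range (T / (k + 1 + 1)),
        charFun (μ.map fun ω => ∑ i ∈ Finset.range (k + 1), e i ω) ((√(T : ℝ))⁻¹ * t) := by
    intro T
    rw [charFun_map_mul_comp (by fun_prop), hN.charFun_sum_blocks (k + 1), Finset.prod_const,
      Finset.card_range]
  simp_rw [e1]
  convert key using 4
  ring_nf

lemma IsOneDependentNoise.tendsto_charFun_sum [IsProbabilityMeasure μ]
    (hN : IsOneDependentNoise e r0 r1 μ) (t : ℝ) :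
    Tendsto (fun T : ℕ => charFun (μ.map fun ω => (√(T : ℝ))⁻¹ * ∑ i ∈ Finset.range T, e i ω) t)
      atTop (𝓝 (Complex.exp (-((r0 + 2 * r1) * t ^ 2 / 2 : ℝ)))) := by
  have hm := hN.measurable
  have hr0 := hN.r0_nonneg
  set z : ℕ → ℂ := fun k =>
    Complex.exp (-((((k : ℝ) + 1) * r0 + 2 * k * r1) / (k + 2) * t ^ 2 / 2 : ℝ)) with hz
  have hzlim : Tendsto z atTop (𝓝 (Complex.exp (-((r0 + 2 * r1) * t ^ 2 / 2 : ℝ)))) := by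
    refine (Complex.continuous_exp.tendsto _).comp ?_
    simp_rw [← Complex.ofReal_neg]
    refine (Complex.continuous_ofReal.tendsto _).comp ?_
    exact (((tendsto_block_variance r0 r1).mul_const (t ^ 2)).div_const 2).neg
  have hgap : Tendsto (fun k : ℕ => |t| * √(r0 / (k + 2))) atTop (𝓝 0) := by
    have h : Tendsto (fun k : ℕ => r0 / ((k : ℝ) + 2)) atTop (𝓝 0) :=
      tendsto_const_nhds.div_atTop (tendsto_natCast_add_const 2)
    simpa using h.sqrt.const_mul |t|
  rw [Metric.tendsto_nhds]
  intro ε hε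
  -- First fix k, so that the gaps cost less than ε/4 uniformly in T and the block limit is within
  -- ε/4 of the target; only then let T grow, which removes the incomplete block.
  obtain ⟨k, hk1, hk2⟩ := ((hgap.eventually_lt_const (show 0 < ε / 4 by linarith)).and
    (Metric.tendsto_nhds.1 hzlim (ε / 4) (by linarith))).exists
  have htail : Tendsto (fun T : ℕ => |t| * ((k + 2) * √r0) * (√(T : ℝ))⁻¹) atTop (𝓝 0) := by
    have hinv : Tendsto (fun T : ℕ => (√(T : ℝ))⁻¹) atTop (𝓝 0) :=
      tendsto_inv_atTop_zero.comp (Real.tendsto_sqrt_atTop.comp tendsto_natCast_atTop_atTop)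
    simpa using hinv.const_mul (|t| * ((k + 2) * √r0))
  filter_upwards [htail.eventually_lt_const (show 0 < ε / 4 by linarith),
    Metric.tendsto_nhds.1 (hN.tendsto_charFun_blocks k t) (ε / 4) (by linarith),
    eventually_gt_atTop 0] with T hT1 hT2 hT0
  set B : Ω → ℝ := fun ω => ∑ j ∈ Finset.range (T / (k + 1 + 1)), ∑ i ∈ Finset.range (k + 1),
    e (j * (k + 1 + 1) + i) ω with hB
  have hBL : MemLp B 2 μ := memLp_finsetSum _ fun j _ => memLp_finsetSum _ fun i _ => hN.memLp _
  have hSL := hN.memLp_sum id T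
  simp only [id] at hSL
  have hT0' : (0 : ℝ) < T := by exact_mod_cast hT0
  have h1 : ‖charFun (μ.map fun ω => (√(T : ℝ))⁻¹ * ∑ i ∈ Finset.range T, e i ω) t
      - charFun (μ.map fun ω => (√(T : ℝ))⁻¹ * B ω) t‖ < ε / 2 := by
    refine lt_of_le_of_lt (norm_charFun_map_sub_le (by fun_prop) (by fun_prop)
      (((hSL.const_mul _).sub (hBL.const_mul _)).integrable (by norm_num)) t) ?_
    have e1 : ∀ ω, |(√(T : ℝ))⁻¹ * ∑ i ∈ Finset.range T, e i ω - (√(T : ℝ))⁻¹ * B ω| =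
        (√(T : ℝ))⁻¹ * |∑ i ∈ Finset.range T, e i ω - B ω| := fun ω => by
      rw [← mul_sub, abs_mul, abs_of_nonneg (by positivity)]
    simp_rw [e1]
    rw [integral_const_mul]
    have h2 := hN.integral_abs_sum_sub_blocks_le (Nat.succ_pos k) T
    have h3 : √((T / (k + 1 + 1) : ℕ) * r0) ≤ √(T : ℝ) * √(r0 / (k + 2)) := by
      rw [← Real.sqrt_mul hT0'.le]
      apply Real.sqrt_le_sqrt
      have : ((T / (k + 1 + 1) : ℕ) : ℝ) ≤ T / ((k + 1 + 1 : ℕ) : ℝ) := Nat.cast_div_le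
      push_cast at this
      calc _ ≤ T / ((k : ℝ) + 1 + 1) * r0 := by gcongr
        _ = _ := by rw [add_assoc, one_add_one_eq_two]; ring
    push_cast at h2
    have hs : 0 < √(T : ℝ) := Real.sqrt_pos.2 hT0'
    calc |t| * ((√(T : ℝ))⁻¹ * ∫ ω, |∑ i ∈ Finset.range T, e i ω - B ω| ∂μ)
        ≤ |t| * ((√(T : ℝ))⁻¹ * (√(T : ℝ) * √(r0 / (k + 2)) + (k + 1 + 1) * √r0)) := by
          gcongr
          refine h2.trans ?_
          gcongr
      _ = |t| * √(r0 / (k + 2)) + |t| * ((k + 2) * √r0) * (√(T : ℝ))⁻¹ := by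
          field_simp
          ring
      _ < ε / 2 := by linarith
  calc dist _ _ ≤ dist _ (charFun (μ.map fun ω => (√(T : ℝ))⁻¹ * B ω) t)
        + dist (charFun (μ.map fun ω => (√(T : ℝ))⁻¹ * B ω) t) (z k)
        + dist (z k) _ := dist_triangle4 _ _ _ _
    _ < ε / 2 + ε / 4 + ε / 4 := by
        rw [← dist_eq_norm] at h1
        gcongr
    _ = ε := by ring

/-- The central limit theorem for `1`-dependent stationary sequences. -/
lemma IsOneDependentNoise.tendstoInDistribution_sum [IsProbabilityMeasure μ]
    (hN : IsOneDependentNoise e r0 r1 μ) :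
    TendstoInDistribution (fun (T : ℕ) ω => (√(T : ℝ))⁻¹ * ∑ i ∈ Finset.range T, e i ω)
      atTop (id : ℝ → ℝ) (fun _ => μ) (gaussianReal 0 (r0 + 2 * r1).toNNReal) where
  forall_aemeasurable T := by
    have hm := hN.measurable
    fun_prop
  tendsto := by
    refine ProbabilityMeasure.tendsto_of_tendsto_charFun fun t => ?_
    have h := hN.tendsto_charFun_sum t
    simp only [ProbabilityMeasure.coe_mk, Measure.map_id, charFun_gaussianReal]
    convert h using 3
    simp [hN.long_run_variance_nonneg]

end OneDependentCLT

/-! ### Sum of squares and maximum of the noise. -/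

section LawOfLargeNumbers

lemma sum_range_eq_sum_even_add_sum_odd (y : ℕ → ℝ) (T : ℕ) :
    ∑ t ∈ Finset.range T, y t =
      ∑ i ∈ Finset.range ((T + 1) / 2), y (2 * i) + ∑ i ∈ Finset.range (T / 2), y (2 * i + 1) := by
  induction T with
  | zero => simp
  | succ T ih =>
    rw [Finset.sum_range_succ, ih]
    rcases Nat.even_or_odd' T with ⟨m, rfl | rfl⟩
    · have h1 : (2 * m + 1 + 1) / 2 = m + 1 := by omega
      have h2 : (2 * m + 1) / 2 = m := by omega
      have h3 : 2 * m / 2 = m := by omega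
      rw [h1, h2, h3, Finset.sum_range_succ _ m]
      ring
    · have h1 : (2 * m + 1 + 1 + 1) / 2 = m + 1 := by omega
      have h2 : (2 * m + 1 + 1) / 2 = m + 1 := by omega
      have h3 : (2 * m + 1) / 2 = m := by omega
      rw [h1, h2, h3, Finset.sum_range_succ (fun i => y (2 * i + 1)) m]
      ring

lemma tendsto_succ_div_two_div :
    Tendsto (fun T : ℕ => (((T + 1) / 2 : ℕ) : ℝ) / T) atTop (𝓝 (1 / 2)) := by
  have hinv : Tendsto (fun T : ℕ => (1 : ℝ) / 2 + 1 / 2 * (T : ℝ)⁻¹) atTop (𝓝 (1 / 2)) := by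
    simpa using (tendsto_inv_atTop_nhds_zero_nat.const_mul (1 / 2 : ℝ)).const_add (1 / 2 : ℝ)
  refine tendsto_of_tendsto_of_tendsto_of_le_of_le' tendsto_const_nhds hinv ?_ ?_
  · filter_upwards [eventually_gt_atTop 0] with T hT
    have hT' : (0 : ℝ) < T := by exact_mod_cast hT
    have h : T ≤ 2 * ((T + 1) / 2) := by omega
    have h' : (T : ℝ) ≤ 2 * ((T + 1) / 2 : ℕ) := by exact_mod_cast h
    rw [le_div_iff₀ hT']; linarith
  · filter_upwards [eventually_gt_atTop 0] with T hT
    have hT' : (0 : ℝ) < T := by exact_mod_cast hT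
    have h : 2 * ((T + 1) / 2) ≤ T + 1 := by omega
    have h' : 2 * (((T + 1) / 2 : ℕ) : ℝ) ≤ T + 1 := by exact_mod_cast h
    rw [div_le_iff₀ hT', add_mul, mul_assoc, inv_mul_cancel₀ hT'.ne']; linarith

lemma tendsto_sum_div_of_tendsto_average {y : ℕ → ℝ} {r c : ℝ} {n : ℕ → ℕ}
    (hn : Tendsto (fun T : ℕ => (n T : ℝ) / T) atTop (𝓝 c)) (hn' : Tendsto n atTop atTop)
    (h : Tendsto (fun k : ℕ => (∑ i ∈ Finset.range k, y i) / k) atTop (𝓝 r)) :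
    Tendsto (fun T : ℕ => (∑ i ∈ Finset.range (n T), y i) / T) atTop (𝓝 (r * c)) := by
  refine ((h.comp hn').mul hn).congr fun T => ?_
  simp only [Function.comp]
  rcases Nat.eq_zero_or_pos (n T) with h0 | h0
  · simp [h0]
  · have : (n T : ℝ) ≠ 0 := by positivity
    field_simp

variable {Ω : Type*} [MeasurableSpace Ω] {μ : Measure Ω} {r0 r1 : ℝ} {e : ℕ → Ω → ℝ}

lemma IsOneDependentNoise.identDistrib (hN : IsOneDependentNoise e r0 r1 μ) (s t : ℕ) :
    IdentDistrib (e s) (e t) μ μ := by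
  have h (s : ℕ) : IdentDistrib (e s) (e 0) μ μ := by
    have := (hN.stationary s).comp (u := fun y : ℕ → ℝ => y 0) (by fun_prop)
    simpa only [Function.comp_def, zero_add] using this
  exact (h s).trans (h t).symm

/-- Along separated indices the squares are pairwise independent, which suffices for the strong law;
even and odd indices are treated separately. -/
lemma IsOneDependentNoise.ae_tendsto_average_sq_comp (hN : IsOneDependentNoise e r0 r1 μ)
    {f : ℕ → ℕ} (hf : ∀ i j, i < j → f i + 2 ≤ f j) :
    ∀ᵐ ω ∂μ, Tendsto (fun n : ℕ => (∑ i ∈ Finset.range n, e (f i) ω ^ 2) / n) atTop (𝓝 r0) := by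
  have h := strong_law_ae_real (fun i ω => e (f i) ω ^ 2) (μ := μ) (hN.memLp _).integrable_sq
    (fun i j hij => by
      rcases lt_or_gt_of_ne hij with h | h
      · exact (hN.indepFun_of_add_two_le (hf i j h)).comp (φ := fun x => x ^ 2)
          (ψ := fun x => x ^ 2) (by fun_prop) (by fun_prop)
      · exact ((hN.indepFun_of_add_two_le (hf j i h)).comp (φ := fun x => x ^ 2)
          (ψ := fun x => x ^ 2) (by fun_prop) (by fun_prop)).symm)
    (fun i => (hN.identDistrib (f i) (f 0)).comp (u := fun x => x ^ 2) (by fun_prop))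
  simpa only [hN.sq] using h

/-- The strong law of large numbers for the squares of `1`-dependent stationary noise. -/
lemma IsOneDependentNoise.ae_tendsto_average_sq (hN : IsOneDependentNoise e r0 r1 μ) :
    ∀ᵐ ω ∂μ, Tendsto (fun T : ℕ => (∑ t ∈ Finset.range T, e t ω ^ 2) / T) atTop (𝓝 r0) := by
  filter_upwards [hN.ae_tendsto_average_sq_comp (f := fun i => 2 * i) (fun i j h => by omega),
    hN.ae_tendsto_average_sq_comp (f := fun i => 2 * i + 1) (fun i j h => by omega)] with ω h1 h2
  have l1 := tendsto_sum_div_of_tendsto_average tendsto_succ_div_two_div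
    ((Nat.tendsto_div_const_atTop (n := 2) (by norm_num)).comp (tendsto_add_atTop_nat 1)) h1
  have l2 := tendsto_sum_div_of_tendsto_average (tendsto_natDiv_div 2 (by norm_num))
    (Nat.tendsto_div_const_atTop (n := 2) (by norm_num)) h2
  have := l1.add l2
  have hr : r0 * (1 / 2) + r0 * (1 / ((2 : ℕ) : ℝ)) = r0 := by push_cast; ring
  rw [hr] at this
  refine this.congr fun T => ?_
  rw [sum_range_eq_sum_even_add_sum_odd (fun t => e t ω ^ 2) T, add_div]

lemma IsOneDependentNoise.tendsto_measureReal_average_sq [IsProbabilityMeasure μ]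
    (hN : IsOneDependentNoise e r0 r1 μ) {δ : ℝ} (hδ : 0 < δ) :
    Tendsto (fun T : ℕ => μ.real {ω | δ ≤ |(∑ t ∈ Finset.range T, e t ω ^ 2) / T - r0|})
      atTop (𝓝 0) := by
  have hm := hN.measurable
  have h := tendstoInMeasure_of_tendsto_ae
    (f := fun (T : ℕ) ω => (∑ t ∈ Finset.range T, e t ω ^ 2) / T) (g := fun _ => r0)
    (fun T => (by fun_prop : Measurable _).aestronglyMeasurable) hN.ae_tendsto_average_sq
  exact tendstoInMeasure_iff_measureReal_norm.1 h δ hδ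

lemma tendsto_integral_indicator_sq_ge {X : Ω → ℝ} (hX : MemLp X 2 μ) (hXm : Measurable X) {c : ℝ}
    (hc : 0 < c) :
    Tendsto (fun T : ℕ => ∫ ω, {ω | c * T ≤ X ω ^ 2}.indicator (fun ω => X ω ^ 2) ω ∂μ) atTop
      (𝓝 0) := by
  have h := tendsto_integral_of_dominated_convergence (μ := μ)
    (F := fun (T : ℕ) ω => {ω | c * T ≤ X ω ^ 2}.indicator (fun ω => X ω ^ 2) ω)
    (f := fun _ => 0) (fun ω => X ω ^ 2)
    (fun T => ((hXm.pow_const 2).indicator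
      (measurableSet_le (by fun_prop) (by fun_prop))).aestronglyMeasurable)
    hX.integrable_sq
    (fun T => ae_of_all _ fun ω => by
      refine (norm_indicator_le_norm_self _ _).trans ?_
      rw [Real.norm_of_nonneg (sq_nonneg _)])
    (ae_of_all _ fun ω => by
      refine tendsto_const_nhds.congr' ?_
      have : Tendsto (fun T : ℕ => c * (T : ℝ)) atTop atTop :=
        tendsto_natCast_atTop_atTop.const_mul_atTop hc
      filter_upwards [this.eventually_gt_atTop (X ω ^ 2)] with T hT
      rw [Set.indicator_of_notMem]
      simpa using hT)
  simpa using h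

/-- The normalised maximum of square integrable identically distributed variables vanishes. -/
lemma IsOneDependentNoise.tendsto_measureReal_max [IsProbabilityMeasure μ]
    (hN : IsOneDependentNoise e r0 r1 μ) {δ : ℝ} (hδ : 0 < δ) :
    Tendsto (fun T : ℕ => μ.real {ω | ∃ t < T, δ ≤ |(√(T : ℝ))⁻¹ * e t ω|}) atTop (𝓝 0) := by
  have hlim := (tendsto_integral_indicator_sq_ge (hN.memLp 0) (hN.measurable 0)
    (pow_pos hδ 2)).const_mul (δ ^ 2)⁻¹
  rw [mul_zero] at hlim
  refine tendsto_of_tendsto_of_tendsto_of_le_of_le' tendsto_const_nhds hlim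
    (Eventually.of_forall fun T => measureReal_nonneg) ?_
  filter_upwards [eventually_gt_atTop 0] with T hT
  have hT' : (0 : ℝ) < T := by exact_mod_cast hT
  have hs : 0 < √(T : ℝ) := Real.sqrt_pos.2 hT'
  have hsub : {ω | ∃ t < T, δ ≤ |(√(T : ℝ))⁻¹ * e t ω|} ⊆
      ⋃ t ∈ Finset.range T, {ω | δ ^ 2 * T ≤ e t ω ^ 2} := by
    rintro ω ⟨t, ht, h⟩
    simp only [Set.mem_iUnion]
    refine ⟨t, Finset.mem_range.2 ht, ?_⟩
    have h2 : δ ^ 2 ≤ ((√(T : ℝ))⁻¹ * e t ω) ^ 2 := by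
      rw [← sq_abs ((√(T : ℝ))⁻¹ * e t ω)]; gcongr
    rw [mul_pow, inv_pow, Real.sq_sqrt hT'.le, inv_mul_eq_div, le_div_iff₀ hT'] at h2
    exact h2
  have hset (t : ℕ) : MeasurableSet {ω | δ ^ 2 * (T : ℝ) ≤ e t ω ^ 2} :=
    measurableSet_le measurable_const ((hN.measurable t).pow_const 2)
  have hsame (t : ℕ) : μ.real {ω | δ ^ 2 * T ≤ e t ω ^ 2} = μ.real {ω | δ ^ 2 * T ≤ e 0 ω ^ 2} := by
    have := (hN.identDistrib t 0).measure_mem_eq (s := {x : ℝ | δ ^ 2 * T ≤ x ^ 2})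
      (measurableSet_le measurable_const (by fun_prop))
    simp only [measureReal_def]
    exact congrArg ENNReal.toReal this
  -- Markov's inequality with the integral kept on the event: its vanishing as T → ∞ offsets the
  -- factor T from the union bound, where the full second moment would give only boundedness.
  have hmark : δ ^ 2 * T * μ.real {ω | δ ^ 2 * T ≤ e 0 ω ^ 2} ≤
      ∫ ω, {ω | δ ^ 2 * (T : ℝ) ≤ e 0 ω ^ 2}.indicator (fun ω => e 0 ω ^ 2) ω ∂μ := by
    rw [integral_indicator (hset 0)]
    have := setIntegral_mono_on (μ := μ) (s := {ω | δ ^ 2 * (T : ℝ) ≤ e 0 ω ^ 2})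
      (f := fun _ => δ ^ 2 * T) (g := fun ω => e 0 ω ^ 2) (integrable_const _)
      (hN.memLp 0).integrable_sq.integrableOn (hset 0) fun ω hω => hω
    rw [setIntegral_const, smul_eq_mul, mul_comm] at this
    exact this
  calc _ ≤ μ.real (⋃ t ∈ Finset.range T, {ω | δ ^ 2 * T ≤ e t ω ^ 2}) :=
        measureReal_mono hsub (measure_ne_top _ _)
    _ ≤ ∑ t ∈ Finset.range T, μ.real {ω | δ ^ 2 * T ≤ e t ω ^ 2} :=
      measureReal_biUnion_finset_le _ _
    _ = T * μ.real {ω | δ ^ 2 * T ≤ e 0 ω ^ 2} := by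
      simp_rw [hsame]; simp
    _ = (δ ^ 2)⁻¹ * (δ ^ 2 * T * μ.real {ω | δ ^ 2 * T ≤ e 0 ω ^ 2}) := by
      field_simp
    _ ≤ _ := by gcongr

lemma tendsto_measureReal_ge_of_tendsto_integral {f : ℕ → Ω → ℝ}
    (hf0 : ∀ T ω, 0 ≤ f T ω) (hf : ∀ T, Integrable (f T) μ)
    (h : Tendsto (fun T => ∫ ω, f T ω ∂μ) atTop (𝓝 0)) {ε : ℝ} (hε : 0 < ε) :
    Tendsto (fun T => μ.real {ω | ε ≤ f T ω}) atTop (𝓝 0) := by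
  have h' := h.const_mul ε⁻¹
  rw [mul_zero] at h'
  refine squeeze_zero (fun T => measureReal_nonneg) (fun T => ?_) h'
  rw [← div_eq_inv_mul, le_div_iff₀ hε, mul_comm]
  exact mul_meas_ge_le_integral_of_nonneg (ae_of_all _ (hf0 T)) (hf T) ε

end LawOfLargeNumbers

/-! ### Conditional laws by freezing an independent variable. -/

section ConditionalLaw

variable {Ω α β : Type*} [MeasurableSpace Ω] [MeasurableSpace α] [MeasurableSpace β]
  {μ : Measure Ω}

/-- The conditional law of `F (A, B)` given `B`, for independent `A` and `B`, is obtained by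
freezing `B`. -/
lemma condDistrib_of_indepFun [IsProbabilityMeasure μ] {A : Ω → α} {B : Ω → β} (hA : Measurable A)
    (hB : Measurable B) (h : IndepFun A B μ) {F : α × β → ℝ} (hF : Measurable F) :
    ∀ᵐ ω ∂μ, condDistrib (fun ω => F (A ω, B ω)) B μ (B ω) =
      (μ.map A).map fun a => F (a, B ω) := by
  have iA : IsProbabilityMeasure (μ.map A) := Measure.isProbabilityMeasure_map hA.aemeasurable
  have iB : IsProbabilityMeasure (μ.map B) := Measure.isProbabilityMeasure_map hB.aemeasurable
  -- The candidate kernel sends b to the law of F(A, b); almost sure uniqueness of disintegrations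
  -- identifies it with `condDistrib`.
  let κ : Kernel β ℝ := (Kernel.const β (μ.map A) ×ₖ Kernel.id).map F
  have hκ (b : β) : κ b = (μ.map A).map fun a => F (a, b) := by
    simp only [κ]
    rw [Kernel.map_apply _ hF, Kernel.prod_apply, Kernel.const_apply, Kernel.id_apply,
      Measure.prod_dirac, Measure.map_map hF (by fun_prop)]
    rfl
  have hcomp : μ.map (fun ω => (B ω, F (A ω, B ω))) = μ.map B ⊗ₘ κ := by
    refine Measure.ext_of_lintegral _ fun f hf => ?_
    have hmap : μ.map (fun ω => (B ω, F (A ω, B ω))) =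
        ((μ.map A).prod (μ.map B)).map fun p => (p.2, F p) := by
      rw [← (indepFun_iff_map_prod_eq_prod_map_map hA.aemeasurable hB.aemeasurable).1 h,
        Measure.map_map (by fun_prop) (by fun_prop)]
      rfl
    rw [hmap, lintegral_map hf (by fun_prop), lintegral_prod_symm _ (by fun_prop),
      Measure.lintegral_compProd hf]
    refine lintegral_congr fun b => ?_
    rw [hκ, lintegral_map (μ := μ.map A) (by fun_prop) (by fun_prop)]
  have := condDistrib_ae_eq_of_measure_eq_compProd_of_measurable hB (by fun_prop) hcomp
  filter_upwards [ae_of_ae_map hB.aemeasurable this] with ω hω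
  rw [hω, hκ]

/-- G is the conditional L¹ distance between F and its approximation M given B, so it bounds the
error of replacing F by M in the conditional law, while its mean is the unconditional L¹ error. -/
lemma ae_blDist_condDistrib_le [IsProbabilityMeasure μ] {A : Ω → α} {B : Ω → β} (hA : Measurable A)
    (hB : Measurable B) (h : IndepFun A B μ) {F M : α × β → ℝ} (hF : Measurable F)
    (hM : Measurable M) (hFM : Integrable (fun ω => F (A ω, B ω) - M (A ω, B ω)) μ)
    (ν : Measure ℝ) [IsProbabilityMeasure ν] :
    ∃ G : Ω → ℝ, (∀ ω, 0 ≤ G ω) ∧ Integrable G μ ∧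
      ∫ ω, G ω ∂μ = ∫ ω, |F (A ω, B ω) - M (A ω, B ω)| ∂μ ∧
      ∀ᵐ ω ∂μ, blDist (condDistrib (fun ω => F (A ω, B ω)) B μ (B ω)) ν ≤
        G ω + blDist (μ.map fun ω' => M (A ω', B ω)) ν := by
  have iA : IsProbabilityMeasure (μ.map A) := Measure.isProbabilityMeasure_map hA.aemeasurable
  have iB : IsProbabilityMeasure (μ.map B) := Measure.isProbabilityMeasure_map hB.aemeasurable
  have hlaw := (indepFun_iff_map_prod_eq_prod_map_map hA.aemeasurable hB.aemeasurable).1 h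
  have hFMm : Measurable fun p => F p - M p := hF.sub hM
  have hint : Integrable (fun p => F p - M p) ((μ.map A).prod (μ.map B)) := by
    rw [← hlaw, integrable_map_measure hFMm.aestronglyMeasurable (by fun_prop)]
    exact hFM
  have hGint := hint.abs.integral_prod_right
  refine ⟨fun ω => ∫ a, |F (a, B ω) - M (a, B ω)| ∂(μ.map A), fun ω =>
    integral_nonneg fun _ => abs_nonneg _, hGint.comp_measurable hB, ?_, ?_⟩
  · rw [← integral_map (f := fun b => ∫ a, |F (a, b) - M (a, b)| ∂(μ.map A)) hB.aemeasurable
      hGint.aestronglyMeasurable, ← integral_prod_symm _ hint.abs, ← hlaw,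
      integral_map (by fun_prop) hFMm.abs.aestronglyMeasurable]
  · filter_upwards [condDistrib_of_indepFun hA hB h hF,
      ae_of_ae_map hB.aemeasurable hint.prod_left_ae] with ω h1 h2
    have hFω : Measurable fun a => F (a, B ω) := by fun_prop
    have hMω : Measurable fun a => M (a, B ω) := by fun_prop
    have iF : IsProbabilityMeasure ((μ.map A).map fun a => F (a, B ω)) :=
      Measure.isProbabilityMeasure_map hFω.aemeasurable
    have iM : IsProbabilityMeasure ((μ.map A).map fun a => M (a, B ω)) :=
      Measure.isProbabilityMeasure_map hMω.aemeasurable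
    have e1 : (μ.map fun ω' => M (A ω', B ω)) = (μ.map A).map fun a => M (a, B ω) := by
      rw [Measure.map_map hMω hA]; rfl
    rw [h1, e1]
    refine (blDist_triangle _ ((μ.map A).map fun a => M (a, B ω)) _).trans ?_
    gcongr
    exact blDist_map_le_integral_abs_sub hFω.aemeasurable hMω.aemeasurable h2

end ConditionalLaw

/-! ### Centring and scaling of the averages. -/

section Averages

lemma sqrt_mul_one_div_mul (T : ℕ) (x : ℝ) : √(T : ℝ) * (1 / (T : ℝ) * x) = (√(T : ℝ))⁻¹ * x := by
  rw [← mul_assoc, mul_one_div, Real.sqrt_div_self]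

lemma sqrt_mul_iterateAverage_sub (θ : ℕ → ℝ) (c : ℝ) (T : ℕ) :
    √(T : ℝ) * (iterateAverage θ T - c) = (√(T : ℝ))⁻¹ * ∑ t ∈ Finset.Icc 1 T, (θ t - c) := by
  rcases Nat.eq_zero_or_pos T with rfl | hT
  · simp
  · have hT' : (T : ℝ) ≠ 0 := by positivity
    rw [← sqrt_mul_one_div_mul, Finset.sum_sub_distrib, iterateAverage, Finset.sum_const,
      nsmul_eq_mul, Nat.card_Icc, Nat.add_sub_cancel]
    field_simp

lemma iterateAverage_congr {θ θ' : ℕ → ℝ} {T : ℕ} (h : ∀ t ≤ T, θ t = θ' t) :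
    iterateAverage θ T = iterateAverage θ' T := by
  unfold iterateAverage
  rw [Finset.sum_congr rfl fun t ht => h t (Finset.mem_Icc.1 ht).2]

lemma iterateAverage_sgdMean_sub {γ ρ θ c : ℝ} (y : ℕ → ℝ) (T : ℕ) :
    √(T : ℝ) * (iterateAverage (sgdMean γ ρ θ y) T - c) =
      (√(T : ℝ))⁻¹ * ∑ t ∈ Finset.Icc 1 T,
        bootstrapSgdMean γ ρ (θ - c) (fun _ => 1) (fun i => y i - c) t := by
  simp_rw [sqrt_mul_iterateAverage_sub, bootstrapSgdMean_sub_const, sgdMean_eq_bootstrapSgdMean]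

lemma iterateAverage_bootstrapSgdMean_sub {γ ρ θ θ' c : ℝ} (v y : ℕ → ℝ) (T : ℕ) :
    √(T : ℝ) * (iterateAverage (bootstrapSgdMean γ ρ θ' v y) T
        - iterateAverage (sgdMean γ ρ θ y) T) =
      (√(T : ℝ))⁻¹ * (∑ t ∈ Finset.Icc 1 T, bootstrapSgdMean γ ρ (θ' - c) v (fun i => y i - c) t
        - ∑ t ∈ Finset.Icc 1 T,
          bootstrapSgdMean γ ρ (θ - c) (fun _ => 1) (fun i => y i - c) t) := by
  rw [mul_sub (√(T : ℝ))⁻¹, ← iterateAverage_sgdMean_sub, ← sub_sub_sub_cancel_right _ _ c, mul_sub,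
    sqrt_mul_iterateAverage_sub (bootstrapSgdMean γ ρ θ' v y) c T]
  simp_rw [bootstrapSgdMean_sub_const]

end Averages

/-! ### The two limit theorems for SGD. -/

section SgdCLT

variable {Ω : Type*} [MeasurableSpace Ω] {μ : Measure Ω} [IsProbabilityMeasure μ]
  {γ ρ θ θ' r0 r1 : ℝ} {V e : ℕ → Ω → ℝ}

/-- The central limit theorem for averaged stochastic gradient descent, centred. -/
lemma IsOneDependentNoise.tendstoInDistribution_randomIterate (hγ : 0 < γ) (hρ0 : 0 < ρ)
    (hρ1 : ρ < 1) (hN : IsOneDependentNoise e r0 r1 μ) :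
    TendstoInDistribution (fun (T : ℕ) ω => (√(T : ℝ))⁻¹ *
        ∑ t ∈ Finset.Icc 1 T, randomIterate γ ρ θ (fun _ _ => 1) e t ω)
      atTop (id : ℝ → ℝ) (fun _ => μ) (gaussianReal 0 (r0 + 2 * r1).toNNReal) := by
  have hW := isWeightSequence_one (μ := μ) e
  have hm := hN.measurable
  have hDm (t : ℕ) : Measurable (randomIterate γ ρ θ (fun _ _ => 1) e t) :=
    measurable_randomIterate hW.measurable hN.measurable t
  have hlim := tendsto_integral_abs_sum_randomIterate_sub (θ := θ) hγ hρ0 hρ1 one_le_two hN hW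
  refine tendstoInDistribution_of_tendstoInMeasure_sub _ _ hN.tendstoInDistribution_sum ?_
    fun T => (by fun_prop : Measurable _).aemeasurable
  rw [tendstoInMeasure_iff_measureReal_norm]
  intro ε hε
  have hi (T : ℕ) := ((memLp_sum_randomIterate_sub (γ := γ) (ρ := ρ) (θ := θ) hN hW T).integrable
    (by norm_num)).abs
  have := tendsto_measureReal_ge_of_tendsto_integral (μ := μ)
    (f := fun (T : ℕ) ω => (√(T : ℝ))⁻¹ *
      |∑ t ∈ Finset.Icc 1 T, randomIterate γ ρ θ (fun _ _ => 1) e t ω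
        - ∑ t ∈ Finset.range T, 1 * e t ω|)
    (fun T ω => by positivity) (fun T => (hi T).const_mul _)
    (by simpa only [integral_const_mul] using hlim) hε
  refine this.congr fun T => ?_
  congr 1
  ext ω
  simp only [Pi.sub_apply, Pi.zero_apply, sub_zero, Set.mem_ofPred_eq, one_mul]
  rw [← mul_sub, norm_mul, Real.norm_eq_abs, Real.norm_eq_abs,
    abs_of_nonneg (show 0 ≤ (√(T : ℝ))⁻¹ by positivity)]

/-- Extension of a finite sequence by zero. -/
def extendByZero (T : ℕ) (d : Fin T → ℝ) (i : ℕ) : ℝ := if h : i < T then d ⟨i, h⟩ else 0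

lemma extendByZero_of_lt {T i : ℕ} (h : i < T) (y : ℕ → ℝ) :
    extendByZero T (fun j : Fin T => y j) i = y i := dif_pos h

@[fun_prop]
lemma measurable_extendByZero (T : ℕ) : Measurable (extendByZero T) := by
  refine measurable_pi_lambda _ fun i => ?_
  unfold extendByZero
  split_ifs <;> fun_prop

/-- The scaled difference of averaged bootstrap and averaged stochastic gradient descent, as a
function of the weights and of the first `T` observations. -/
noncomputable def bootstrapDifference (γ ρ θ θ' : ℝ) (T : ℕ) (p : (ℕ → ℝ) × (Fin T → ℝ)) : ℝ :=
  √(T : ℝ) * (iterateAverage (bootstrapSgdMean γ ρ θ' p.1 (extendByZero T p.2)) T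
    - iterateAverage (sgdMean γ ρ θ (extendByZero T p.2)) T)

/-- The linear approximation of `bootstrapDifference`. -/
noncomputable def linearDifference (c : ℝ) (T : ℕ) (p : (ℕ → ℝ) × (Fin T → ℝ)) : ℝ :=
  ∑ i ∈ Finset.range T, (√(T : ℝ))⁻¹ * (extendByZero T p.2 i - c) * (p.1 i - 1)

lemma measurable_bootstrapDifference (T : ℕ) : Measurable (bootstrapDifference γ ρ θ θ' T) := by
  unfold bootstrapDifference
  simp_rw [iterateAverage, sgdMean_eq_bootstrapSgdMean]
  have h1 (t : ℕ) : Measurable fun p : (ℕ → ℝ) × (Fin T → ℝ) =>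
      bootstrapSgdMean γ ρ θ' p.1 (extendByZero T p.2) t :=
    (measurable_bootstrapSgdMean θ' t).comp
      (measurable_fst.prodMk ((measurable_extendByZero T).comp measurable_snd))
  have h2 (t : ℕ) : Measurable fun p : (ℕ → ℝ) × (Fin T → ℝ) =>
      bootstrapSgdMean γ ρ θ (fun _ => 1) (extendByZero T p.2) t :=
    (measurable_bootstrapSgdMean θ t).comp
      (measurable_const.prodMk ((measurable_extendByZero T).comp measurable_snd))
  fun_prop

lemma measurable_linearDifference (c : ℝ) (T : ℕ) : Measurable (linearDifference c T) := by
  unfold linearDifference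
  fun_prop

lemma bootstrapDifference_restrict (T : ℕ) (v y : ℕ → ℝ) :
    bootstrapDifference γ ρ θ θ' T (v, fun i => y i) =
      √(T : ℝ) * (iterateAverage (bootstrapSgdMean γ ρ θ' v y) T
        - iterateAverage (sgdMean γ ρ θ y) T) := by
  unfold bootstrapDifference
  have h (t : ℕ) (ht : t ≤ T) (θ : ℝ) (v : ℕ → ℝ) :
      bootstrapSgdMean γ ρ θ v (extendByZero T fun i => y i) t = bootstrapSgdMean γ ρ θ v y t :=
    bootstrapSgdMean_congr (fun _ _ => rfl) fun i hi => extendByZero_of_lt (hi.trans_le ht) y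
  congr 2
  · exact iterateAverage_congr fun t ht => h t ht _ _
  · exact iterateAverage_congr fun t ht => by
      rw [sgdMean_eq_bootstrapSgdMean, sgdMean_eq_bootstrapSgdMean]; exact h t ht _ _

lemma linearDifference_restrict (c : ℝ) (T : ℕ) (v y : ℕ → ℝ) :
    linearDifference c T (v, fun i => y i) =
      ∑ i ∈ Finset.range T, (√(T : ℝ))⁻¹ * (y i - c) * (v i - 1) :=
  Finset.sum_congr rfl fun i hi => by rw [extendByZero_of_lt (Finset.mem_range.1 hi)]

/-- The difference of the linearization errors for weights V and for weights 1; the latter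
subtraction turns V into V - 1. -/
lemma bootstrapDifference_sub_linearDifference {Ω : Type*} {V Y : ℕ → Ω → ℝ} {c : ℝ} (T : ℕ)
    (ω : Ω) :
    bootstrapDifference γ ρ θ θ' T (fun t => V t ω, fun i => Y i ω)
      - linearDifference c T (fun t => V t ω, fun i => Y i ω) =
    (√(T : ℝ))⁻¹ * ((∑ t ∈ Finset.Icc 1 T, randomIterate γ ρ (θ' - c) V (fun t ω => Y t ω - c) t ω
        - ∑ t ∈ Finset.range T, V t ω * (Y t ω - c))
      - (∑ t ∈ Finset.Icc 1 T,
          randomIterate γ ρ (θ - c) (fun _ _ => 1) (fun t ω => Y t ω - c) t ω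
        - ∑ t ∈ Finset.range T, 1 * (Y t ω - c))) := by
  have h1 := bootstrapDifference_restrict (γ := γ) (ρ := ρ) (θ := θ) (θ' := θ') T
    (fun t => V t ω) (fun t => Y t ω)
  have h2 := linearDifference_restrict c T (fun t => V t ω) (fun t => Y t ω)
  rw [iterateAverage_bootstrapSgdMean_sub (c := c)] at h1
  have h3 : ∑ i ∈ Finset.range T, (√(T : ℝ))⁻¹ * (Y i ω - c) * (V i ω - 1) =
      (√(T : ℝ))⁻¹ * (∑ t ∈ Finset.range T, V t ω * (Y t ω - c)
        - ∑ t ∈ Finset.range T, 1 * (Y t ω - c)) := by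
    rw [← Finset.sum_sub_distrib, Finset.mul_sum]
    exact Finset.sum_congr rfl fun i _ => by ring
  rw [h1, h2, h3]
  simp only [randomIterate]
  ring

variable {Y : ℕ → Ω → ℝ} {c : ℝ}

lemma tendsto_integral_abs_bootstrapDifference_sub (hγ : 0 < γ) (hρ0 : 0 < ρ) (hρ1 : ρ < 1)
    (hN : IsOneDependentNoise (fun t ω => Y t ω - c) r0 r1 μ)
    (hW : IsWeightSequence V (fun t ω => Y t ω - c) 2 μ) :
    (∀ T : ℕ, Integrable (fun ω => bootstrapDifference γ ρ θ θ' T (fun t => V t ω, fun i => Y i ω)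
      - linearDifference c T (fun t => V t ω, fun i => Y i ω)) μ) ∧
    Tendsto (fun T : ℕ => ∫ ω, |bootstrapDifference γ ρ θ θ' T (fun t => V t ω, fun i => Y i ω)
      - linearDifference c T (fun t => V t ω, fun i => Y i ω)| ∂μ) atTop (𝓝 0) := by
  have hW1 := isWeightSequence_one (μ := μ) fun t ω => Y t ω - c
  have i1 (T : ℕ) := (memLp_sum_randomIterate_sub (γ := γ) (ρ := ρ) (θ := θ' - c) hN hW
    T).integrable (by norm_num)
  have i2 (T : ℕ) := (memLp_sum_randomIterate_sub (γ := γ) (ρ := ρ) (θ := θ - c) hN hW1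
    T).integrable (by norm_num)
  have l1 := tendsto_integral_abs_sum_randomIterate_sub (θ := θ' - c) hγ hρ0 hρ1 le_rfl hN hW
  have l2 := tendsto_integral_abs_sum_randomIterate_sub (θ := θ - c) hγ hρ0 hρ1 one_le_two hN hW1
  have hl := l1.add l2
  rw [add_zero] at hl
  simp_rw [bootstrapDifference_sub_linearDifference]
  refine ⟨fun T => ((i1 T).sub (i2 T)).const_mul _,
    squeeze_zero (fun T => integral_nonneg fun _ => abs_nonneg _) (fun T => ?_) hl⟩
  rw [← mul_add, ← integral_add (i1 T).abs (i2 T).abs, ← integral_const_mul]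
  refine integral_mono (((i1 T).sub (i2 T)).const_mul _).abs
    (((i1 T).abs.add (i2 T).abs).const_mul _) fun ω => ?_
  simp only [abs_mul]
  rw [abs_of_nonneg (show 0 ≤ (√(T : ℝ))⁻¹ by positivity)]
  exact mul_le_mul_of_nonneg_left (abs_sub _ _) (by positivity)

/-- The conditional central limit theorem for averaged bootstrap stochastic gradient descent. -/
lemma condTendstoInDistribution_bootstrapDifference (hγ : 0 < γ) (hρ0 : 0 < ρ) (hρ1 : ρ < 1)
    (hYmeas : ∀ t, Measurable (Y t)) (hVmeas : ∀ t, Measurable (V t))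
    (hN : IsOneDependentNoise (fun t ω => Y t ω - c) r0 r1 μ)
    (hW : IsWeightSequence V (fun t ω => Y t ω - c) 2 μ) (hVindep : iIndepFun V μ)
    (hVident : ∀ t, IdentDistrib (V t) (V 0) μ μ)
    (hVY : IndepFun (fun ω t => V t ω) (fun ω t => Y t ω) μ) :
    CondTendstoInDistribution
      (fun (T : ℕ) ω => bootstrapDifference γ ρ θ θ' T (fun t => V t ω, fun i => Y i ω))
      (fun (T : ℕ) ω (i : Fin T) => Y i ω) (gaussianReal 0 r0.toNNReal) μ := by
  have hV : Measurable fun ω t => V t ω := measurable_pi_lambda _ hVmeas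
  have hD (T : ℕ) : Measurable fun ω (i : Fin T) => Y i ω :=
    measurable_pi_lambda _ fun i => hYmeas i
  refine ⟨fun T => ((measurable_bootstrapDifference T).comp (hV.prodMk (hD T))).aemeasurable,
    fun T => (hD T).aemeasurable, ?_⟩
  have hind (T : ℕ) : IndepFun (fun ω t => V t ω) (fun ω (i : Fin T) => Y i ω) μ :=
    hVY.comp (φ := id) (ψ := fun (y : ℕ → ℝ) (i : Fin T) => y i) measurable_id (by fun_prop)
  obtain ⟨hint, hlim⟩ := tendsto_integral_abs_bootstrapDifference_sub (θ := θ) (θ' := θ') hγ hρ0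
    hρ1 hN hW
  choose G hG0 hGi hGeq hGle using fun T => ae_blDist_condDistrib_le hV (hD T) (hind T)
    (measurable_bootstrapDifference (γ := γ) (ρ := ρ) (θ := θ) (θ' := θ') T)
    (measurable_linearDifference c T) (hint T) (gaussianReal 0 r0.toNNReal)
  rw [tendstoInMeasure_iff_measureReal_norm]
  intro ε hε
  have hZL (i : ℕ) : MemLp (fun ω => V i ω - 1) 2 μ := (hW.memLp i).sub (memLp_const 1)
  have hZ0 : ∫ ω, (V 0 ω - 1) ∂μ = 0 := by
    rw [integral_sub ((hW.memLp 0).integrable (by norm_num)) (integrable_const _), hW.mean]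
    simp
  have hZ1 : ∫ ω, (V 0 ω - 1) ^ 2 ∂μ = 1 := by rw [hW.integral_sq_sub_one]; norm_num
  -- A threshold δ that does not depend on T or the data, valid for all weights satisfying the two
  -- smallness conditions.
  obtain ⟨δ, hδ, hclt⟩ := exists_forall_blDist_weighted_sum_lt hZL
    (hVindep.comp (fun _ x => x - 1) fun _ => by fun_prop)
    (fun i => (hVident i).comp (u := fun x => x - 1) (by fun_prop)) hZ0 hZ1 hN.r0_nonneg
    (half_pos hε)
  have s1 := tendsto_measureReal_ge_of_tendsto_integral hG0 hGi (by simpa only [hGeq] using hlim)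
    (half_pos hε)
  -- A large distance forces one of three rare events: a large linearization cost, an average square
  -- far from r(0), or a large single weight.
  have hsum := (s1.add (hN.tendsto_measureReal_average_sq hδ)).add (hN.tendsto_measureReal_max hδ)
  simp only [add_zero] at hsum
  refine squeeze_zero (fun T => measureReal_nonneg) (fun T => ?_) hsum
  refine le_trans ?_ ((measureReal_union_le _ _).trans (add_le_add_left
    (measureReal_union_le _ _) _))
  refine ENNReal.toReal_mono (measure_ne_top _ _) (measure_mono_ae ?_)
  filter_upwards [hGle T] with ω hω hbad
  by_contra hgood
  have hgood' : G T ω < ε / 2 ∧ |(∑ t ∈ Finset.range T, (Y t ω - c) ^ 2) / T - r0| < δ ∧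
      ∀ t < T, |(√(T : ℝ))⁻¹ * (Y t ω - c)| < δ := by
    refine ⟨?_, ?_, fun t ht => ?_⟩ <;> by_contra! hcon
    · exact hgood (Or.inl (Or.inl hcon))
    · exact hgood (Or.inl (Or.inr hcon))
    · exact hgood (Or.inr ⟨t, ht, hcon⟩)
  obtain ⟨g1, g2, g3⟩ := hgood'
  have hb := hclt T (fun i => (√(T : ℝ))⁻¹ * (Y i ω - c)) (by
    simp_rw [mul_pow, inv_pow, Real.sq_sqrt (Nat.cast_nonneg T)]
    rwa [← Finset.mul_sum, ← div_eq_inv_mul]) g3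
  have hlin : (fun ω' => linearDifference c T (fun t => V t ω', fun i : Fin T => Y i ω)) =
      fun ω' => ∑ i ∈ Finset.range T, (√(T : ℝ))⁻¹ * (Y i ω - c) * (V i ω' - 1) :=
    funext fun ω' => linearDifference_restrict c T (fun t => V t ω') fun t => Y t ω
  rw [hlin] at hω
  have hbad' : ε ≤ ‖blDist (condDistrib (fun ω => bootstrapDifference γ ρ θ θ' T
      (fun t => V t ω, fun i => Y i ω)) (fun ω (i : Fin T) => Y i ω) μ (fun i => Y i ω))
      (gaussianReal 0 r0.toNNReal) - 0‖ := hbad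
  rw [sub_zero, Real.norm_of_nonneg (blDist_nonneg _ _)] at hbad'
  linarith

end SgdCLT

lemma gaussianReal_ne_of_covariance_ne_zero {r0 r1 : ℝ} (h0 : 0 ≤ r0) (h01 : 0 ≤ r0 + 2 * r1)
    (h1 : r1 ≠ 0) : gaussianReal 0 (r0 + 2 * r1).toNNReal ≠ gaussianReal 0 r0.toNNReal := by
  intro h
  have h2 := (gaussianReal_ext_iff.1 h).2
  rw [Real.toNNReal_eq_toNNReal_iff h01 h0] at h2
  exact h1 (by linarith)

theorem proposition1 {Ω : Type*} [MeasurableSpace Ω] (μ : Measure Ω) [IsProbabilityMeasure μ]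
    (Y V : ℕ → Ω → ℝ) (θstar r0 r1 γ ρ θ₀ θ₀' : ℝ)
    -- the data: a stationary, `1`-dependent sequence with finite second moments
    (hYmeas : ∀ t, Measurable (Y t)) (hYL2 : ∀ t, MemLp (Y t) 2 μ)
    (hYstat : IsStationarySeq Y μ) (hYdep : IsMDependent 1 Y μ)
    (hYmean : ∀ t, ∫ ω, Y t ω ∂μ = θstar)
    (hr0 : ∀ t, ∫ ω, (Y t ω - θstar) ^ 2 ∂μ = r0)
    (hr1 : ∀ t, ∫ ω, (Y t ω - θstar) * (Y (t + 1) ω - θstar) ∂μ = r1)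
    -- the weights: i.i.d. with mean one and unit variance, independent of the data
    (hVmeas : ∀ t, Measurable (V t)) (hVL2 : ∀ t, MemLp (V t) 2 μ)
    (hVindep : iIndepFun V μ) (hVident : ∀ t, IdentDistrib (V t) (V 0) μ μ)
    (hVmean : ∀ t, ∫ ω, V t ω ∂μ = 1) (hVvar : ∀ t, variance (V t) μ = 1)
    (hVY : IndepFun (fun ω t => V t ω) (fun ω t => Y t ω) μ)
    -- the learning rate
    (hγ : 0 < γ) (hρ : ρ ∈ Set.Ioo (1 / 2 : ℝ) 1) :
    -- the limiting variances are genuine variances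
    0 ≤ r0 ∧ 0 ≤ r0 + 2 * r1 ∧
    -- averaged SGD
    TendstoInDistribution
      (fun (T : ℕ) ω =>
        √(T : ℝ) * (iterateAverage (sgdMean γ ρ θ₀ (fun t => Y t ω)) T - θstar))
      atTop (id : ℝ → ℝ) (fun _ => μ) (gaussianReal 0 (r0 + 2 * r1).toNNReal) ∧
    -- averaged bootstrap SGD, conditionally on the first `T` observations
    CondTendstoInDistribution
      (fun (T : ℕ) ω =>
        √(T : ℝ) * (iterateAverage (bootstrapSgdMean γ ρ θ₀' (fun t => V t ω) (fun t => Y t ω)) T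
          - iterateAverage (sgdMean γ ρ θ₀ (fun t => Y t ω)) T))
      (fun (T : ℕ) ω (i : Fin T) => Y i ω) (gaussianReal 0 r0.toNNReal) μ ∧
    -- the two limits differ as soon as consecutive observations are correlated
    (r1 ≠ 0 → gaussianReal 0 (r0 + 2 * r1).toNNReal ≠ gaussianReal 0 r0.toNNReal) := by
  have hN := isOneDependentNoise_sub_const hYmeas hYL2 hYstat hYdep hYmean hr0 hr1
  -- Variance 1 plus squared mean 1; this is the extreme case m = 2 allowed by the moment bounds.
  have hVsq (t : ℕ) : ∫ ω, V t ω ^ 2 ∂μ = 2 := by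
    have h := hVvar t
    rw [variance_eq_sub (hVL2 t), hVmean] at h
    simp only [Pi.pow_apply] at h
    linarith
  have hVe : IndepFun (fun ω t => V t ω) (fun ω t => Y t ω - θstar) μ :=
    hVY.comp (φ := id) (ψ := fun (y : ℕ → ℝ) t => y t - θstar) measurable_id (by fun_prop)
  have hW := isWeightSequence_of_iIndepFun hVmeas hVL2 hVindep hVmean hVsq hN.measurable hVe
  have hρ0 : 0 < ρ := by linarith [hρ.1]
  refine ⟨hN.r0_nonneg, hN.long_run_variance_nonneg, ?_, ?_,
    gaussianReal_ne_of_covariance_ne_zero hN.r0_nonneg hN.long_run_variance_nonneg⟩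
  · simp_rw [iterateAverage_sgdMean_sub]
    exact hN.tendstoInDistribution_randomIterate (θ := θ₀ - θstar) hγ hρ0 hρ.2
  · have h := condTendstoInDistribution_bootstrapDifference (θ := θ₀) (θ' := θ₀') hγ hρ0 hρ.2
      hYmeas hVmeas hN hW hVindep hVident hVY
    have e (T : ℕ) (ω : Ω) := bootstrapDifference_restrict (γ := γ) (ρ := ρ) (θ := θ₀)
      (θ' := θ₀') T (fun t => V t ω) (fun t => Y t ω)
    simpa only [e] using h
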